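/- Let $A\in SL(2,\mathbb Z)$ have eigenvalues $0<\lambda^{-1}<1<\lambda$, and denote also by $A$ the induced linear Anosov diffeomorphism of $\mathbb T^2=\mathbb R^2/\mathbb Z^2$. Let $\pi\colon S\to\mathbb T^2$ be the (real) blow-up of $\mathbb T^2$ at the fixed point $p=(0,0)$, with its natural real-analytic structure and with exceptional fibre $C=\pi^{-1}(p)=\mathbb{RP}^1$ (the lines in $T_p\mathbb T^2=\mathbb R^2$), and let $f_A\colon S\to S$ be the lift of $A$, a real-analytic diffeomorphism with $\pi\circ f_A=A\circ\pi$ which acts on $C$ as the projectivization of $A$. Let $p_1,p_2\in C$ be the two fixed points of $f_A$ on $C$, where $p_1$ is the eigendirection of $A$ for $\lambda$ and $p_2$ the eigendirection for $\lambda^{-1}$. Let $\mathcal M(f_A)$ be the set of $f_A$-invariant Borel probability measures on $S$. **Theorem.** Let $\mu\in\mathcal M(f_A)$. 1. There is a sequence $(\nu_n)$ of ergodic measures in $\mathcal M(f_A)$ that converges to $\mu$ in the weak$*$ topology if and only if $\mu\in\{\delta_{p_1},\delta_{p_2}\}$ or $\mu(\{p_1\})=\mu(\{p_2\})$. 2.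 If $\mu\in\{\delta_{p_1},\delta_{p_2}\}$, then every sequence $(\nu_n)$ of ergodic measures in $\mathcal M(f_A)$ that converges to $\mu$ in the weak$*$ topology satisfies $\nu_n=\mu$ for all large $n$. 3. If $\mu(\{p_1\})=\mu(\{p_2\})$, then $\mu$ is the weak$*$ limit of a sequence of invariant probability measures, each equidistributed on a periodic orbit of $f_A$ whose Lyapunov exponents are $\log\lambda$ and $-\log\lambda$. -/

import Mathlib

open scoped ContDiff Manifold LinearAlgebra.Projectivization Topology

noncomputable section

namespace TorusBlowUp

/-- The torus `𝕋² = ℝ²/ℤ²`. -/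
abbrev Torus : Type := UnitAddCircle × UnitAddCircle

/-- The projection `ℝ² → 𝕋²`. -/
def toTorus (v : ℝ × ℝ) : Torus := ((v.1 : UnitAddCircle), (v.2 : UnitAddCircle))

/-- The linear map of `ℝ²` with matrix `A`. -/
def planeMap (A : Matrix.SpecialLinearGroup (Fin 2) ℤ) : (ℝ × ℝ) →ₗ[ℝ] (ℝ × ℝ) where
  toFun v := (A 0 0 * v.1 + A 0 1 * v.2, A 1 0 * v.1 + A 1 1 * v.2)
  map_add' v w := by ext <;> simp <;> ring
  map_smul' c v := by ext <;> simp <;> ring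

/-- The automorphism of `𝕋²` induced by `A`. -/
def torusMap (A : Matrix.SpecialLinearGroup (Fin 2) ℤ) (x : Torus) : Torus :=
  (A 0 0 • x.1 + A 0 1 • x.2, A 1 0 • x.1 + A 1 1 • x.2)

theorem planeMap_inv (A : Matrix.SpecialLinearGroup (Fin 2) ℤ) (v : ℝ × ℝ) :
    planeMap A⁻¹ (planeMap A v) = v := by
  have h := A.det_coe
  rw [Matrix.det_fin_two] at h
  have h' : (A 0 0 : ℝ) * A 1 1 - A 0 1 * A 1 0 = 1 := by exact_mod_cast h
  ext
  · simp [planeMap, Matrix.SpecialLinearGroup.coe_inv, Matrix.adjugate_fin_two]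
    linear_combination v.1 * h'
  · simp [planeMap, Matrix.SpecialLinearGroup.coe_inv, Matrix.adjugate_fin_two]
    linear_combination v.2 * h'

theorem planeMap_injective (A : Matrix.SpecialLinearGroup (Fin 2) ℤ) :
    Function.Injective (planeMap A) :=
  Function.LeftInverse.injective (planeMap_inv A)

theorem planeMap_one (v : ℝ × ℝ) : planeMap 1 v = v := by
  simp [planeMap]

theorem torusMap_toTorus (A : Matrix.SpecialLinearGroup (Fin 2) ℤ) (v : ℝ × ℝ) :
    torusMap A (toTorus v) = toTorus (planeMap A v) := by
  ext
  · simp [torusMap, toTorus, planeMap, ← zsmul_eq_mul]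
  · simp [torusMap, toTorus, planeMap, ← zsmul_eq_mul]

theorem toTorus_surjective : Function.Surjective toTorus := by
  rintro ⟨x, y⟩
  obtain ⟨a, rfl⟩ := QuotientAddGroup.mk_surjective x
  obtain ⟨b, rfl⟩ := QuotientAddGroup.mk_surjective y
  exact ⟨(a, b), rfl⟩

theorem torusMap_inv (A : Matrix.SpecialLinearGroup (Fin 2) ℤ) (x : Torus) :
    torusMap A⁻¹ (torusMap A x) = x := by
  obtain ⟨v, rfl⟩ := toTorus_surjective x
  rw [torusMap_toTorus, torusMap_toTorus, planeMap_inv]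

theorem torusMap_zero (A : Matrix.SpecialLinearGroup (Fin 2) ℤ) : torusMap A 0 = 0 := by
  simp [torusMap]

theorem torusMap_ne_zero (A : Matrix.SpecialLinearGroup (Fin 2) ℤ) {x : Torus} (hx : x ≠ 0) :
    torusMap A x ≠ 0 := fun h => hx (by rw [← torusMap_inv A x, h, torusMap_zero])

theorem toTorus_add (v w : ℝ × ℝ) : toTorus (v + w) = toTorus v + toTorus w := by
  simp [toTorus]

theorem toTorus_sub (v w : ℝ × ℝ) : toTorus (v - w) = toTorus v - toTorus w := by
  simp [toTorus]

theorem toTorus_zero : toTorus 0 = 0 := by simp [toTorus]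

theorem continuous_toTorus : Continuous toTorus :=
  ((AddCircle.continuous_mk' (1 : ℝ)).comp continuous_fst).prodMk
    ((AddCircle.continuous_mk' (1 : ℝ)).comp continuous_snd)

theorem eq_of_coe_eq {s t a : ℝ} (h : (s : UnitAddCircle) = t)
    (hs : s ∈ Set.Ioo a (a + 1)) (ht : t ∈ Set.Ioo a (a + 1)) : s = t :=
  (AddCircle.coe_eq_coe_iff_of_mem_Ico (a := a) (Set.Ioo_subset_Ico_self hs)
    (Set.Ioo_subset_Ico_self ht)).1 h

/-- The blow-up of `𝕋²` at the point `0`: the points of `𝕋² ∖ {0}`, together with the exceptional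
fibre `ℝℙ¹` of lines through the origin of `T₀𝕋² = ℝ²`. -/
inductive BlowUp : Type
  | pt (x : Torus) (hx : x ≠ 0) : BlowUp
  | dir (l : ℙ ℝ (ℝ × ℝ)) : BlowUp

instance : Nonempty BlowUp := ⟨.dir (Projectivization.mk ℝ (1, 0) (by simp))⟩

/-- The point of the blow-up above `toTorus v`, in the direction of `d` if `toTorus v = 0`. -/
def mkPoint (v d : ℝ × ℝ) (hd : d ≠ 0) : BlowUp :=
  open Classical in
  if h : toTorus v = 0 then .dir (Projectivization.mk ℝ d hd) else .pt (toTorus v) h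

/-- An index of a chart of the blow-up: `away a` is an affine chart of `𝕋² ∖ {0}` given by the unit
box with lower left corner `a`; `near P` is the chart around the exceptional fibre minus one line
that is given by the linear coordinates `P` of `ℝ²`. -/
inductive ChartIndex : Type
  | away (a : ℝ × ℝ) : ChartIndex
  | near (P : (ℝ × ℝ) ≃L[ℝ] (ℝ × ℝ)) : ChartIndex

namespace ChartIndex

/-- The map of the parameter domain to `ℝ²`; in linear coordinates, the usual blow-up chart
`(u, m) ↦ (u, u m)` for the charts at the exceptional fibre. -/
def base : ChartIndex → ℝ × ℝ → ℝ × ℝ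
  | away _, z => z
  | near P, z => P (z.1, z.1 * z.2)

/-- The direction in which the parametrization approaches the exceptional fibre (irrelevant for the
charts `away a`, which do not meet it). -/
def slope : ChartIndex → ℝ × ℝ → ℝ × ℝ
  | away _, _ => (1, 0)
  | near P, z => P (1, z.2)

theorem slope_ne_zero (i : ChartIndex) (z : ℝ × ℝ) : i.slope z ≠ 0 := by
  cases i <;> simp [slope]

/-- The open domain in `ℝ²` of the parametrization. -/
def domain : ChartIndex → Set (ℝ × ℝ)
  | away a => {z | z.1 ∈ Set.Ioo a.1 (a.1 + 1) ∧ z.2 ∈ Set.Ioo a.2 (a.2 + 1) ∧ toTorus z ≠ 0}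
  | near P => {z | (base (near P) z).1 ∈ Set.Ioo (-1 / 2 : ℝ) (1 / 2) ∧
      (base (near P) z).2 ∈ Set.Ioo (-1 / 2 : ℝ) (1 / 2)}

/-- The inverse of the chart. For `near P` it is `(u, m) ↦ P (u, u m) mod ℤ²` if `u ≠ 0`, and
`(0, m)` goes to the line spanned by `P (1, m)`. -/
def param (i : ChartIndex) (z : ℝ × ℝ) : BlowUp := mkPoint (i.base z) (i.slope z) (i.slope_ne_zero z)

end ChartIndex

/-- The lift to the blow-up of the automorphism of `𝕋²` induced by `A`: it acts as `A` on
`𝕋² ∖ {0}` and as the projectivization of `A` on the exceptional fibre. -/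
def lift (A : Matrix.SpecialLinearGroup (Fin 2) ℤ) : BlowUp → BlowUp
  | .pt x hx => .pt (torusMap A x) (torusMap_ne_zero A hx)
  | .dir l => .dir (Projectivization.map (planeMap A) (planeMap_injective A) l)

theorem lift_one (x : BlowUp) : lift 1 x = x := by
  cases x with
  | pt x hx => simp [lift, torusMap]
  | dir l =>
    induction l using Projectivization.ind with
    | h v hv => simp [lift, Projectivization.map_mk, planeMap_one]

theorem lift_inv (A : Matrix.SpecialLinearGroup (Fin 2) ℤ) (x : BlowUp) :
    lift A⁻¹ (lift A x) = x := by
  cases x with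
  | pt x hx => simp [lift, torusMap_inv]
  | dir l =>
    induction l using Projectivization.ind with
    | h v hv => simp [lift, Projectivization.map_mk, planeMap_inv]

theorem lift_mkPoint (A : Matrix.SpecialLinearGroup (Fin 2) ℤ) (v d : ℝ × ℝ) (hd : d ≠ 0) :
    lift A (mkPoint v d hd) =
      mkPoint (planeMap A v) (planeMap A d)
        (by simpa using (planeMap_injective A).ne hd) := by
  by_cases h : toTorus v = 0
  · have h' : toTorus (planeMap A v) = 0 := by rw [← torusMap_toTorus, h, torusMap_zero]
    simp [mkPoint, h, h', lift, Projectivization.map_mk]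
  · have h' : toTorus (planeMap A v) ≠ 0 := by
      rw [← torusMap_toTorus]; exact torusMap_ne_zero A h
    simp [mkPoint, h, h', lift, torusMap_toTorus]

theorem mkPoint_eq_iff (v d w e : ℝ × ℝ) (hd : d ≠ 0) (he : e ≠ 0) :
    mkPoint v d hd = mkPoint w e he ↔ toTorus v = toTorus w ∧
      (toTorus v = 0 → Projectivization.mk ℝ d hd = Projectivization.mk ℝ e he) := by
  by_cases h : toTorus v = 0 <;> by_cases h' : toTorus w = 0
  · simp [mkPoint, h, h']
  · simp [mkPoint, h, h', Ne.symm h']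
  · simp [mkPoint, h, h']
  · simp [mkPoint, h, h']

namespace ChartIndex

theorem contDiff_base (i : ChartIndex) : ContDiff ℝ ω i.base := by
  cases i with
  | away a => exact contDiff_id
  | near P =>
    exact P.contDiff.comp (contDiff_fst.prodMk (contDiff_fst.mul contDiff_snd))

theorem contDiff_planeMap (A : Matrix.SpecialLinearGroup (Fin 2) ℤ) :
    ContDiff ℝ ω (planeMap A) := (LinearMap.toContinuousLinearMap (planeMap A)).contDiff

theorem isOpen_domain (i : ChartIndex) : IsOpen i.domain := by
  cases i with
  | away a =>
    exact (isOpen_Ioo.preimage continuous_fst).inter ((isOpen_Ioo.preimage continuous_snd).inter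
      ((isOpen_compl_singleton (x := (0 : Torus))).preimage continuous_toTorus))
  | near P =>
    have h := (contDiff_base (near P)).continuous
    exact (isOpen_Ioo.preimage (continuous_fst.comp h)).inter
      (isOpen_Ioo.preimage (continuous_snd.comp h))

theorem eq_of_box {v w a : ℝ × ℝ} (h : toTorus v = toTorus w)
    (hv : v.1 ∈ Set.Ioo a.1 (a.1 + 1)) (hv' : v.2 ∈ Set.Ioo a.2 (a.2 + 1))
    (hw : w.1 ∈ Set.Ioo a.1 (a.1 + 1)) (hw' : w.2 ∈ Set.Ioo a.2 (a.2 + 1)) : v = w :=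
  Prod.ext (eq_of_coe_eq (congrArg Prod.fst h) hv hw) (eq_of_coe_eq (congrArg Prod.snd h) hv' hw')

theorem base_eq_of_near {P Q : (ℝ × ℝ) ≃L[ℝ] (ℝ × ℝ)} {z w : ℝ × ℝ} (hz : z ∈ (near P).domain)
    (hw : w ∈ (near Q).domain) (h : toTorus ((near P).base z) = toTorus ((near Q).base w)) :
    (near P).base z = (near Q).base w := by
  obtain ⟨⟨h1, h2⟩, h3, h4⟩ := hz
  obtain ⟨⟨h5, h6⟩, h7, h8⟩ := hw
  refine eq_of_box (a := (-1 / 2, -1 / 2)) h ?_ ?_ ?_ ?_ <;>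
    exact ⟨by simpa using by assumption, by norm_num; linarith⟩

theorem near_fst_eq_zero {P : (ℝ × ℝ) ≃L[ℝ] (ℝ × ℝ)} {z : ℝ × ℝ} (hz : z ∈ (near P).domain)
    (h : toTorus ((near P).base z) = 0) : z.1 = 0 := by
  have h0 : ((0, 0) : ℝ × ℝ) ∈ (near P).domain := by
    have : P ((0, 0) : ℝ × ℝ) = 0 := map_zero P
    simp [domain, base, this]
    norm_num
  have hb : (near P).base (0, 0) = 0 := by
    have : P ((0, 0) : ℝ × ℝ) = 0 := map_zero P
    simp [base, this]
  have := base_eq_of_near hz h0 (by rw [h, hb, toTorus_zero])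
  rw [hb] at this
  simpa [base] using congrArg Prod.fst ((map_eq_zero_iff P P.injective).1 this)

theorem injOn_param (i : ChartIndex) : Set.InjOn i.param i.domain := by
  intro z hz w hw h
  rw [param, param, mkPoint_eq_iff] at h
  obtain ⟨h1, h2⟩ := h
  cases i with
  | away a => exact eq_of_box h1 hz.1 hz.2.1 hw.1 hw.2.1
  | near P =>
    have hb := P.injective (base_eq_of_near hz hw h1)
    obtain ⟨hb1, hb2⟩ := Prod.mk.inj hb
    refine Prod.ext hb1 ?_
    by_cases h0 : z.1 = 0
    · have hz0 : toTorus ((near P).base z) = 0 := by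
        have : P ((0, 0) : ℝ × ℝ) = 0 := map_zero P
        simp [base, h0, this, toTorus_zero]
      obtain ⟨c, hc⟩ := (Projectivization.mk_eq_mk_iff' ℝ _ _ _ _).1 (h2 hz0)
      simp only [slope] at hc
      rw [← map_smul] at hc
      have hc' := P.injective hc
      simp at hc'
      obtain ⟨rfl, hc'⟩ := hc'
      simpa using hc'.symm
    · rw [← hb1] at hb2
      exact mul_left_cancel₀ h0 hb2

/-- Away from the exceptional fibre the parametrizations are local analytic diffeomorphisms
onto their images in the plane. -/
theorem exists_section (j : ChartIndex) {w : ℝ × ℝ} (hw : toTorus (j.base w) ≠ 0) :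
    ∃ s : ℝ × ℝ → ℝ × ℝ, ContDiffAt ℝ ω s (j.base w) ∧ s (j.base w) = w ∧
      ∀ᶠ v in 𝓝 (j.base w), j.base (s v) = v := by
  cases j with
  | away a => exact ⟨id, contDiffAt_id, rfl, Filter.Eventually.of_forall fun _ => rfl⟩
  | near Q =>
    have hw1 : w.1 ≠ 0 := by
      intro h
      apply hw
      have : Q ((0, 0) : ℝ × ℝ) = 0 := map_zero Q
      simp [base, h, this, toTorus_zero]
    have hQ : Q.symm ((near Q).base w) = (w.1, w.1 * w.2) := by simp [base]
    have hne : (Q.symm ((near Q).base w)).1 ≠ 0 := by rw [hQ]; exact hw1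
    have hc : ContDiffAt ℝ ω (fun v => Q.symm v) ((near Q).base w) := Q.symm.contDiff.contDiffAt
    refine ⟨fun v => ((Q.symm v).1, (Q.symm v).2 / (Q.symm v).1),
      hc.fst.prodMk (hc.snd.div hc.fst hne), ?_, ?_⟩
    · simp [hQ, hw1]
    · have hev : ∀ᶠ v in 𝓝 ((near Q).base w), (Q.symm v).1 ≠ 0 :=
        hc.fst.continuousAt.eventually_ne hne
      filter_upwards [hev] with v hv
      simp only [base]
      rw [mul_div_cancel₀ _ hv]
      simp

/-- In the charts, the lift is given by analytic maps. -/
theorem exists_local_lift (A : Matrix.SpecialLinearGroup (Fin 2) ℤ) (i j : ChartIndex)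
    {z₀ w₀ : ℝ × ℝ} (hz : z₀ ∈ i.domain) (hw : w₀ ∈ j.domain)
    (h : j.param w₀ = lift A (i.param z₀)) :
    ∃ φ : ℝ × ℝ → ℝ × ℝ, ContDiffAt ℝ ω φ z₀ ∧ φ z₀ = w₀ ∧
      ∀ᶠ z in 𝓝 z₀, j.param (φ z) = lift A (i.param z) := by
  simp only [param, lift_mkPoint, mkPoint_eq_iff] at h ⊢
  obtain ⟨h1, h2⟩ := h
  by_cases h0 : toTorus (j.base w₀) = 0
  · specialize h2 h0
    have h0' : toTorus (i.base z₀) = 0 := by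
      by_contra hne
      exact torusMap_ne_zero A hne (by rw [torusMap_toTorus, ← h1, h0])
    cases i with
    | away a => exact absurd h0' hz.2.2
    | near P =>
    cases j with
    | away a => exact absurd h0 hw.2.2
    | near Q =>
    have hz1 := near_fst_eq_zero hz h0'
    have hw1 := near_fst_eq_zero hw h0
    let M : (ℝ × ℝ) →L[ℝ] (ℝ × ℝ) :=
      (Q.symm : (ℝ × ℝ) →L[ℝ] (ℝ × ℝ)).comp
        ((LinearMap.toContinuousLinearMap (planeMap A)).comp (P : (ℝ × ℝ) →L[ℝ] (ℝ × ℝ)))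
    have hM : ∀ v, M v = Q.symm (planeMap A (P v)) := fun v => rfl
    have hQM : ∀ v, Q (M v) = planeMap A (P v) := fun v => by rw [hM]; simp
    obtain ⟨c, hc⟩ := (Projectivization.mk_eq_mk_iff' ℝ _ _ _ _).1 h2
    simp only [slope] at hc
    rw [← hQM, ← map_smul] at hc
    have hc' := Q.injective hc
    have hc1 : c * (M (1, z₀.2)).1 = 1 := congrArg Prod.fst hc'
    have hc2 : c * (M (1, z₀.2)).2 = w₀.2 := congrArg Prod.snd hc'
    have hα : (M (1, z₀.2)).1 ≠ 0 := right_ne_zero_of_mul (hc1 ▸ one_ne_zero)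
    have hcd : ContDiffAt ℝ ω (fun z : ℝ × ℝ => M (1, z.2)) z₀ :=
      (M.contDiff.comp (contDiff_const.prodMk contDiff_snd)).contDiffAt
    refine ⟨fun z => (z.1 * (M (1, z.2)).1, (M (1, z.2)).2 / (M (1, z.2)).1),
      (contDiffAt_fst.mul hcd.fst).prodMk (hcd.snd.div hcd.fst hα), ?_, ?_⟩
    · refine Prod.ext (by simp [hz1, hw1]) ?_
      simp only
      rw [← hc2, div_eq_iff hα]
      linear_combination (-(M (1, z₀.2)).2) * hc1
    · have hev : ∀ᶠ z in 𝓝 z₀, (M (1, z.2)).1 ≠ 0 := hcd.fst.continuousAt.eventually_ne hα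
      filter_upwards [hev] with z hz'
      have hb : (near Q).base (z.1 * (M (1, z.2)).1, (M (1, z.2)).2 / (M (1, z.2)).1)
          = planeMap A ((near P).base z) := by
        simp only [base]
        rw [← hQM]
        congr 1
        have : ((z.1, z.1 * z.2) : ℝ × ℝ) = z.1 • (1, z.2) := by simp
        rw [this, map_smul]
        ext
        · simp
        · simp; field_simp
      refine ⟨by rw [hb], fun _ => ?_⟩
      rw [Projectivization.mk_eq_mk_iff']
      refine ⟨((M (1, z.2)).1)⁻¹, ?_⟩
      simp only [slope]
      rw [← hQM, ← map_smul]
      congr 1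
      ext
      · simp [hz']
      · simp; field_simp
  · obtain ⟨s, hs, hs0, hsev⟩ := exists_section j h0
    let k := j.base w₀ - planeMap A (i.base z₀)
    have hk : toTorus k = 0 := by rw [toTorus_sub, h1, sub_self]
    let G : ℝ × ℝ → ℝ × ℝ := fun z => planeMap A (i.base z) + k
    have hG0 : G z₀ = j.base w₀ := by simp [G, k]
    have hG : ContDiffAt ℝ ω G z₀ :=
      (((contDiff_planeMap A).comp i.contDiff_base).add contDiff_const).contDiffAt
    have hGt : ∀ z, toTorus (G z) = toTorus (planeMap A (i.base z)) := fun z => by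
      simp [G, toTorus_add, hk]
    refine ⟨fun z => s (G z), ContDiffAt.comp z₀ (by rw [hG0]; exact hs) hG, (congrArg s hG0).trans hs0, ?_⟩
    have e1 : ∀ᶠ z in 𝓝 z₀, j.base (s (G z)) = G z := by
      rw [← hG0] at hsev
      exact hG.continuousAt.eventually hsev
    have e2 : ∀ᶠ z in 𝓝 z₀, toTorus (G z) ≠ 0 :=
      (continuous_toTorus.continuousAt.comp hG.continuousAt).eventually_ne
        (by simpa [hG0] using h0)
    filter_upwards [e1, e2] with z hz1 hz2
    rw [hz1]
    exact ⟨hGt z, fun h => absurd h hz2⟩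

/-- The chart with index `i`. -/
def chart (i : ChartIndex) : PartialEquiv BlowUp (ℝ × ℝ) :=
  (i.injOn_param.toPartialEquiv i.param i.domain).symm

theorem chart_apply_param (i : ChartIndex) {z : ℝ × ℝ} (hz : z ∈ i.domain) :
    i.chart (i.param z) = z :=
  (i.injOn_param.toPartialEquiv i.param i.domain).left_inv hz

theorem lift_in_charts (A : Matrix.SpecialLinearGroup (Fin 2) ℤ) (i j : ChartIndex)
    {z₀ : ℝ × ℝ} (hz : z₀ ∈ i.domain) (h : lift A (i.param z₀) ∈ j.param '' j.domain) :
    ContDiffAt ℝ ω (fun z => j.chart (lift A (i.param z))) z₀ ∧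
      ∀ᶠ z in 𝓝 z₀, z ∈ i.domain ∧ lift A (i.param z) ∈ j.param '' j.domain := by
  obtain ⟨w₀, hw, hw'⟩ := h
  obtain ⟨φ, hφ, hφ0, hev⟩ := exists_local_lift A i j hz hw hw'
  have e1 : ∀ᶠ z in 𝓝 z₀, φ z ∈ j.domain :=
    hφ.continuousAt.eventually (by rw [hφ0]; exact j.isOpen_domain.mem_nhds hw)
  have e2 : ∀ᶠ z in 𝓝 z₀, z ∈ i.domain := i.isOpen_domain.mem_nhds hz
  constructor
  · refine hφ.congr_of_eventuallyEq ?_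
    filter_upwards [e1, hev] with z h1 h2
    rw [← h2, chart_apply_param j h1]
  · filter_upwards [e1, e2, hev] with z h1 h2 h3
    exact ⟨h2, φ z, h1, h3⟩

theorem exists_chart (x : BlowUp) : ∃ i : ChartIndex, x ∈ i.chart.source := by
  cases x with
  | pt x hx =>
    obtain ⟨v, rfl⟩ := toTorus_surjective x
    refine ⟨away (v.1 - 1 / 2, v.2 - 1 / 2), v, ⟨?_, ?_, hx⟩, by simp [param, base, mkPoint, hx]⟩
    · constructor <;> simp only <;> linarith
    · constructor <;> simp only <;> linarith
  | dir l =>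
    induction l using Projectivization.ind with
    | h v hv =>
    have key : ∀ (P : (ℝ × ℝ) ≃L[ℝ] (ℝ × ℝ)) (m c : ℝ), c • v = P (1, m) →
        BlowUp.dir (Projectivization.mk ℝ v hv) ∈ (near P).chart.source := by
      intro P m c hc
      have hb : (near P).base (0, m) = 0 := by
        have : P ((0, 0) : ℝ × ℝ) = 0 := map_zero P
        simp [base, this]
      refine ⟨(0, m), by simp [domain, hb]; norm_num, ?_⟩
      simp only [param, mkPoint, hb, toTorus_zero, dite_true]
      congr 1
      rw [Projectivization.mk_eq_mk_iff']
      exact ⟨c, hc⟩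
    by_cases h1 : v.1 = 0
    · have h2 : v.2 ≠ 0 := fun h2 => hv (Prod.ext h1 h2)
      exact ⟨_, key (ContinuousLinearEquiv.prodComm ℝ ℝ ℝ) 0 (v.2)⁻¹ (by ext <;> simp [h1, h2])⟩
    · exact ⟨_, key (ContinuousLinearEquiv.refl ℝ (ℝ × ℝ)) (v.2 / v.1) (v.1)⁻¹
        (by ext <;> simp [h1]; field_simp)⟩

end ChartIndex

theorem transition_source (i j : ChartIndex) : (i.chart.symm.trans j.chart).source =
    {z | z ∈ i.domain ∧ lift 1 (i.param z) ∈ j.param '' j.domain} := by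
  ext z
  simp only [lift_one]
  rfl

theorem transition_apply (i j : ChartIndex) : ⇑(i.chart.symm.trans j.chart) =
    fun z => j.chart (lift 1 (i.param z)) := by
  ext1 z
  simp only [lift_one]
  rfl

theorem transition_open (i j : ChartIndex) : IsOpen (i.chart.symm.trans j.chart).source := by
  rw [transition_source, isOpen_iff_mem_nhds]
  exact fun z hz => (i.lift_in_charts 1 j hz.1 hz.2).2

theorem transition_contDiffOn (i j : ChartIndex) :
    ContDiffOn ℝ ω (i.chart.symm.trans j.chart) (i.chart.symm.trans j.chart).source := by
  rw [transition_source, transition_apply]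
  exact fun z hz => (i.lift_in_charts 1 j hz.1 hz.2).1.contDiffWithinAt

/-- The atlas of the blow-up, which defines its topology and its analytic structure. -/
def core : ChartedSpaceCore (ℝ × ℝ) BlowUp where
  atlas := Set.range ChartIndex.chart
  chartAt x := (ChartIndex.exists_chart x).choose.chart
  mem_chart_source x := (ChartIndex.exists_chart x).choose_spec
  chart_mem_atlas x := ⟨_, rfl⟩
  open_source := by
    rintro _ _ ⟨i, rfl⟩ ⟨j, rfl⟩
    exact transition_open i j
  continuousOn_toFun := by
    rintro _ _ ⟨i, rfl⟩ ⟨j, rfl⟩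
    exact (transition_contDiffOn i j).continuousOn

instance : TopologicalSpace BlowUp := core.toTopologicalSpace

instance : ChartedSpace (ℝ × ℝ) BlowUp := core.toChartedSpace

instance : MeasurableSpace BlowUp := borel BlowUp

instance : BorelSpace BlowUp := ⟨rfl⟩

theorem exists_index {e : OpenPartialHomeomorph BlowUp (ℝ × ℝ)}
    (he : e ∈ atlas (ℝ × ℝ) BlowUp) : ∃ i : ChartIndex, e.toPartialEquiv = i.chart := by
  change e ∈ ⋃ (e : PartialEquiv BlowUp (ℝ × ℝ)) (he : e ∈ core.atlas),
    {core.openPartialHomeomorph e he} at he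
  simp only [Set.mem_iUnion, Set.mem_singleton_iff] at he
  obtain ⟨_, ⟨i, rfl⟩, rfl⟩ := he
  exact ⟨i, rfl⟩

/-- The blow-up is a real-analytic surface. -/
instance : IsManifold 𝓘(ℝ, ℝ × ℝ) ω BlowUp := by
  refine isManifold_of_contDiffOn _ _ _ fun e e' he he' => ?_
  obtain ⟨i, hi⟩ := exists_index he
  obtain ⟨j, hj⟩ := exists_index he'
  have h := transition_contDiffOn i j
  rw [← hi, ← hj] at h
  simpa using h

theorem contMDiff_lift (A : Matrix.SpecialLinearGroup (Fin 2) ℤ) :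
    ContMDiff 𝓘(ℝ, ℝ × ℝ) 𝓘(ℝ, ℝ × ℝ) ω (lift A) := by
  intro x
  obtain ⟨i, hi⟩ := exists_index (chart_mem_atlas (ℝ × ℝ) x)
  obtain ⟨j, hj⟩ := exists_index (chart_mem_atlas (ℝ × ℝ) (lift A x))
  set e := chartAt (ℝ × ℝ) x with he
  set e' := chartAt (ℝ × ℝ) (lift A x) with he'
  let N : Set (ℝ × ℝ) := {z | z ∈ i.domain ∧ lift A (i.param z) ∈ j.param '' j.domain}
  have hN : IsOpen N := isOpen_iff_mem_nhds.2 fun z hz => (i.lift_in_charts A j hz.1 hz.2).2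
  have hes : e.source = i.param '' i.domain := congrArg PartialEquiv.source hi
  have hes' : e'.source = j.param '' j.domain := congrArg PartialEquiv.source hj
  have hec : ∀ y, e y = i.chart y := fun y => congrFun (congrArg PartialEquiv.toFun hi) y
  have hec' : ∀ y, e' y = j.chart y := fun y => congrFun (congrArg PartialEquiv.toFun hj) y
  have hei : ∀ z, e.symm z = i.param z := fun z => congrFun (congrArg PartialEquiv.invFun hi) z
  have hs : IsOpen (e.source ∩ e ⁻¹' N) := e.isOpen_inter_preimage hN
  have hmem : ∀ y, y ∈ e.source ∩ e ⁻¹' N ↔ y ∈ e.source ∧ lift A y ∈ e'.source := by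
    intro y
    refine and_congr_right fun hy => ?_
    rw [hes] at hy
    obtain ⟨z, hz, rfl⟩ := hy
    rw [Set.mem_preimage, hec, i.chart_apply_param hz, hes']
    exact ⟨fun h => h.2, fun h => ⟨hz, h⟩⟩
  have hx : x ∈ e.source ∩ e ⁻¹' N :=
    (hmem x).2 ⟨mem_chart_source (ℝ × ℝ) x, mem_chart_source (ℝ × ℝ) (lift A x)⟩
  have key : ContMDiffOn 𝓘(ℝ, ℝ × ℝ) 𝓘(ℝ, ℝ × ℝ) ω (lift A) (e.source ∩ e ⁻¹' N) := by
    rw [contMDiffOn_iff_of_mem_maximalAtlas' (IsManifold.chart_mem_maximalAtlas x)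
      (IsManifold.chart_mem_maximalAtlas (lift A x)) Set.inter_subset_left
      (fun y hy => ((hmem y).1 hy).2)]
    rintro _ ⟨y, hy, rfl⟩
    have hyN : i.chart y ∈ N := by rw [← hec]; exact hy.2
    have h := (i.lift_in_charts A j hyN.1 hyN.2).1
    have h' : ContDiffAt ℝ ω (fun z => e' (lift A (e.symm z))) (e y) := by
      simp only [hec', hei, hec]; exact h
    exact h'.contDiffWithinAt
  exact key.contMDiffAt (hs.mem_nhds hx)

/-- The canonical projection of the blow-up onto the torus. -/
def proj : BlowUp → Torus
  | .pt x _ => x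
  | .dir _ => 0

theorem proj_lift (A : Matrix.SpecialLinearGroup (Fin 2) ℤ) (x : BlowUp) :
    proj (lift A x) = torusMap A (proj x) := by
  cases x with
  | pt x hx => rfl
  | dir l => exact (torusMap_zero A).symm

/-- The analytic diffeomorphism `f_A` of the blow-up. -/
def diffeo (A : Matrix.SpecialLinearGroup (Fin 2) ℤ) :
    Diffeomorph 𝓘(ℝ, ℝ × ℝ) 𝓘(ℝ, ℝ × ℝ) BlowUp BlowUp ω where
  toFun := lift A
  invFun := lift A⁻¹
  left_inv := lift_inv A
  right_inv x := by simpa using lift_inv A⁻¹ x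
  contMDiff_toFun := contMDiff_lift A
  contMDiff_invFun := contMDiff_lift A⁻¹

/-- The derivative `T_x S → T_x S` at `x` of the iterate of `f` to the (minimal) period of the
periodic point `x`. -/
def periodDeriv (f : BlowUp → BlowUp) (x : BlowUp) : (ℝ × ℝ) →ₗ[ℝ] (ℝ × ℝ) :=
  ContinuousLinearMap.toLinearMap (M := ℝ × ℝ) (M₂ := ℝ × ℝ)
    (mfderiv 𝓘(ℝ, ℝ × ℝ) 𝓘(ℝ, ℝ × ℝ) f^[Function.minimalPeriod f x] x)

/-- The Lyapunov exponents, with multiplicity, of the orbit of a periodic point `x` of period `n`: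
the numbers `log |z| / n` for the (complex) eigenvalues `z` of the derivative of `fⁿ` at `x`. -/
def lyapunovExponents (f : BlowUp → BlowUp) (x : BlowUp) : Multiset ℝ :=
  ((periodDeriv f x).charpoly.map (algebraMap ℝ ℂ)).roots.map
    fun z => Real.log ‖z‖ / (Function.minimalPeriod f x : ℝ)

/-- The invariant probability measure equidistributed on the orbit of a periodic point `x`. -/
def orbitMeasure (f : BlowUp → BlowUp) (x : BlowUp) : MeasureTheory.Measure BlowUp :=
  (Function.minimalPeriod f x : ENNReal)⁻¹ •
    ∑ k ∈ Finset.range (Function.minimalPeriod f x), MeasureTheory.Measure.dirac (f^[k] x)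

end TorusBlowUp

end

/-!
The obstruction to approximation by ergodic measures is the *growth cocycle*
`φ(x) = log |A x|² - log |x|²`, where `|x|` is the distance from `0` on the torus. Near `0` its value
depends on the direction of `x` only, so it extends to a continuous function on the blow-up
(`continuous_growth`), with the values `2 log λ` at `p₁` and `-2 log λ` at `p₂`. Off the exceptional
fibre it is a coboundary, so it integrates to zero against every invariant measure that does not
charge the fibre (`integral_eq_zero_of_coboundary`). On the fibre, which `A` moves from `p₂` to `p₁`,
invariant measures are carried by `{p₁, p₂}` (`Diagonalizes.ae_fibre`). Hence
`∫ φ dμ = 2 log λ (μ {p₁} - μ {p₂})` for every invariant `μ` (`Diagonalizes.integral_growth`). An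
ergodic measure for which this integral is positive is `δ_{p₁}`, and one for which it is negative is
`δ_{p₂}`. By weak continuity of the integral, an ergodic sequence whose limit has
`μ {p₁} ≠ μ {p₂}` is eventually constant, equal to one of the two Dirac measures
(`Diagonalizes.eventually_eq_of_tendsto`).

Conversely let `μ {p₁} = μ {p₂}`. On the torus, nonzero periodic orbits are dense among the invariant
measures (`Diagonalizes.mem_closure_map_proj`). This follows from the specification property
(`Diagonalizes.specification`), which for a linear map amounts to solving an affine recurrence in
eigencoordinates, applied to orbit segments that start at a sample drawn by the law of large
numbers. By compactness of the space of probability measures on the blow-up, the periodic orbits off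
the fibre accumulate at some invariant `μ'` with the same projection to the torus as `μ`. As `φ` has
integral zero along these orbits, also `μ' {p₁} = μ' {p₂}`, and a measure with this property is
determined by its projection (`Diagonalizes.eq_of_map_proj_eq`), so `μ' = μ`
(`Diagonalizes.mem_closure_periodicMeasures`). In a chart, the return map along a periodic orbit off
the fibre is conjugate to a power of `A` composed with a translation, whence the Lyapunov exponents
(`Diagonalizes.lyapunovExponents_eq`).
-/

namespace TorusBlowUp

open Filter Set MeasureTheory

/-! ### Topology of the blow-up -/

theorem mkPoint_of_eq_zero {v d : ℝ × ℝ} {hd : d ≠ 0} (h : toTorus v = 0) :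
    mkPoint v d hd = .dir (Projectivization.mk ℝ d hd) := by
  simp [mkPoint, h]

theorem mkPoint_of_ne_zero {v d : ℝ × ℝ} {hd : d ≠ 0} (h : toTorus v ≠ 0) :
    mkPoint v d hd = .pt (toTorus v) h := by
  simp [mkPoint, h]

theorem proj_mkPoint (v d : ℝ × ℝ) (hd : d ≠ 0) : proj (mkPoint v d hd) = toTorus v := by
  by_cases h : toTorus v = 0
  · simp [mkPoint_of_eq_zero h, h, proj]
  · simp [mkPoint_of_ne_zero h, proj]

theorem proj_eq_zero_iff {x : BlowUp} : proj x = 0 ↔ ∃ l, x = .dir l := by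
  cases x with
  | pt x hx => simp [proj, hx]
  | dir l => simp [proj]

theorem proj_injOn : InjOn proj {x | proj x ≠ 0} := by
  intro x hx y hy h
  cases x with
  | dir l => exact absurd rfl hx
  | pt x hx' =>
    cases y with
    | dir l => exact absurd rfl hy
    | pt y hy' =>
      obtain rfl : x = y := h
      rfl

namespace ChartIndex

theorem proj_param (i : ChartIndex) (z : ℝ × ℝ) : proj (i.param z) = toTorus (i.base z) :=
  proj_mkPoint _ _ _

/-- The chart with index `i` as a homeomorphism of open sets. -/
noncomputable def homeo (i : ChartIndex) : OpenPartialHomeomorph BlowUp (ℝ × ℝ) :=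
  core.openPartialHomeomorph i.chart ⟨i, rfl⟩

theorem homeo_param (i : ChartIndex) {z : ℝ × ℝ} (hz : z ∈ i.domain) : i.homeo (i.param z) = z :=
  i.chart_apply_param hz

theorem continuousOn_param (i : ChartIndex) : ContinuousOn i.param i.domain :=
  i.homeo.continuousOn_symm

end ChartIndex

theorem exists_param_eq (x : BlowUp) : ∃ i : ChartIndex, ∃ z ∈ i.domain, i.param z = x := by
  obtain ⟨i, z, hz, h⟩ := ChartIndex.exists_chart x
  exact ⟨i, z, hz, h⟩

theorem continuous_of_param {Y : Type*} [TopologicalSpace Y] {g : BlowUp → Y}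
    (h : ∀ (i : ChartIndex), ∀ z ∈ i.domain, ContinuousAt (fun z => g (i.param z)) z) :
    Continuous g := by
  rw [continuous_iff_continuousAt]
  intro x
  obtain ⟨i, z, hz, rfl⟩ := exists_param_eq x
  have hs : i.param z ∈ i.homeo.source := ⟨z, hz, rfl⟩
  have h1 : ContinuousAt (fun z => g (i.param z)) (i.homeo (i.param z)) := by
    rw [i.homeo_param hz]
    exact h i z hz
  refine (h1.comp (i.homeo.continuousAt hs)).congr ?_
  filter_upwards [i.homeo.open_source.mem_nhds hs] with y hy
  exact congrArg g (i.homeo.left_inv hy)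

theorem continuous_proj : Continuous proj := by
  refine continuous_of_param fun i z _ => ?_
  simp only [i.proj_param]
  exact (continuous_toTorus.comp i.contDiff_base.continuous).continuousAt

theorem continuous_lift (A : Matrix.SpecialLinearGroup (Fin 2) ℤ) : Continuous (lift A) :=
  (contMDiff_lift A).continuous

/-- The linear coordinates of the plane given by a basis. -/
noncomputable def basisCoords (v w : ℝ × ℝ) (h : v.1 * w.2 - v.2 * w.1 ≠ 0) :
    (ℝ × ℝ) ≃L[ℝ] (ℝ × ℝ) :=
  LinearEquiv.toContinuousLinearEquiv
    { toFun := fun z => z.1 • v + z.2 • w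
      map_add' := fun a b => by ext <;> simp <;> ring
      map_smul' := fun c a => by ext <;> simp <;> ring
      invFun := fun z => ((z.1 * w.2 - z.2 * w.1) / (v.1 * w.2 - v.2 * w.1),
        (v.1 * z.2 - v.2 * z.1) / (v.1 * w.2 - v.2 * w.1))
      left_inv := fun z => by
        ext
        · simp only [Prod.fst_add, Prod.snd_add, Prod.smul_fst, Prod.smul_snd, smul_eq_mul]
          rw [div_eq_iff h]; ring
        · simp only [Prod.fst_add, Prod.snd_add, Prod.smul_fst, Prod.smul_snd, smul_eq_mul]
          rw [div_eq_iff h]; ring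
      right_inv := fun z => by
        ext
        · simp only [Prod.fst_add, Prod.smul_fst, smul_eq_mul]
          rw [div_mul_eq_mul_div, div_mul_eq_mul_div, ← add_div, div_eq_iff h]; ring
        · simp only [Prod.snd_add, Prod.smul_snd, smul_eq_mul]
          rw [div_mul_eq_mul_div, div_mul_eq_mul_div, ← add_div, div_eq_iff h]; ring }

theorem basisCoords_apply (v w : ℝ × ℝ) (h : v.1 * w.2 - v.2 * w.1 ≠ 0) (z : ℝ × ℝ) :
    basisCoords v w h z = z.1 • v + z.2 • w := rfl

theorem mem_domain_near_zero (P : (ℝ × ℝ) ≃L[ℝ] (ℝ × ℝ)) (m : ℝ) :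
    (0, m) ∈ (ChartIndex.near P).domain := by
  have hb : (ChartIndex.near P).base (0, m) = 0 := by
    have : P ((0, 0) : ℝ × ℝ) = 0 := map_zero P
    simp [ChartIndex.base, this]
  simp [ChartIndex.domain, hb]
  norm_num

/-- The point with coordinates `(0, m)` in the chart `near P` is the line spanned by `P (1, m)`. -/
theorem param_near_zero (P : (ℝ × ℝ) ≃L[ℝ] (ℝ × ℝ)) {m c : ℝ} {d : ℝ × ℝ} (hd : d ≠ 0)
    (h : c • d = P (1, m)) :
    (ChartIndex.near P).param (0, m) = .dir (Projectivization.mk ℝ d hd) := by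
  have hb : (ChartIndex.near P).base (0, m) = 0 := by
    have : P ((0, 0) : ℝ × ℝ) = 0 := map_zero P
    simp [ChartIndex.base, this]
  refine (mkPoint_of_eq_zero (by rw [hb, toTorus_zero])).trans (congrArg _ ?_)
  exact (Projectivization.mk_eq_mk_iff' ℝ _ _ _ _).2 ⟨c, h⟩

theorem det_ne_zero_of_mk_ne {v w : ℝ × ℝ} (hv : v ≠ 0) (hw : w ≠ 0)
    (h : Projectivization.mk ℝ v hv ≠ Projectivization.mk ℝ w hw) :
    v.1 * w.2 - v.2 * w.1 ≠ 0 := by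
  intro hd
  apply h
  rw [Projectivization.mk_eq_mk_iff']
  by_cases h1 : w.1 = 0
  · have h2 : w.2 ≠ 0 := fun h2 => hw (Prod.ext h1 h2)
    have hv1 : v.1 = 0 := by simpa [h1, h2] using hd
    exact ⟨v.2 / w.2, by ext <;> simp [h1, h2, hv1]⟩
  · refine ⟨v.1 / w.1, ?_⟩
    ext
    · simp [h1]
    · simp only [Prod.smul_snd, smul_eq_mul]
      rw [div_mul_eq_mul_div, div_eq_iff h1]
      linarith

/-- Points with different projections are separated by the projection; two lines on the exceptional
fibre lie in a common chart. -/
instance : T2Space BlowUp := by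
  refine ⟨fun x y hxy => ?_⟩
  by_cases h : proj x = proj y
  · by_cases h0 : proj x = 0
    · obtain ⟨l, rfl⟩ := proj_eq_zero_iff.1 h0
      obtain ⟨l', rfl⟩ := proj_eq_zero_iff.1 (h ▸ h0)
      induction l using Projectivization.ind with
      | h v hv =>
      induction l' using Projectivization.ind with
      | h w hw =>
      have hne := det_ne_zero_of_mk_ne hv hw (fun h => hxy (by rw [h]))
      -- In the basis `v, w`, up to scaling, the two lines have slopes `1` and `-1` with respect to
      -- the axes spanned by `v + w` and `v - w`.
      have hne' : (v + w).1 * (v - w).2 - (v + w).2 * (v - w).1 ≠ 0 := by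
        intro h'
        apply hne
        simp only [Prod.fst_add, Prod.snd_add, Prod.fst_sub, Prod.snd_sub] at h'
        linarith
      set P := basisCoords (v + w) (v - w) hne' with hP
      have e1 : BlowUp.dir (Projectivization.mk ℝ v hv) = (ChartIndex.near P).param (0, 1) := by
        refine (param_near_zero P (c := 2) _ ?_).symm
        rw [hP, basisCoords_apply]
        ext <;> simp <;> ring
      have e2 : BlowUp.dir (Projectivization.mk ℝ w hw) = (ChartIndex.near P).param (0, -1) := by
        refine (param_near_zero P (c := 2) _ ?_).symm
        rw [hP, basisCoords_apply]
        ext <;> simp <;> ring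
      obtain ⟨U, V, hU, hV, hxU, hyV, hUV⟩ :=
        t2_separation (show ((0, 1) : ℝ × ℝ) ≠ (0, -1) by norm_num)
      let e := (ChartIndex.near P).homeo
      refine ⟨e.source ∩ e ⁻¹' U, e.source ∩ e ⁻¹' V, e.isOpen_inter_preimage hU,
        e.isOpen_inter_preimage hV, ?_, ?_, ?_⟩
      · rw [e1]
        refine ⟨⟨_, mem_domain_near_zero P 1, rfl⟩, ?_⟩
        rw [mem_preimage, (ChartIndex.near P).homeo_param (mem_domain_near_zero P 1)]
        exact hxU
      · rw [e2]
        refine ⟨⟨_, mem_domain_near_zero P (-1), rfl⟩, ?_⟩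
        rw [mem_preimage, (ChartIndex.near P).homeo_param (mem_domain_near_zero P (-1))]
        exact hyV
      · exact (hUV.preimage e).mono inter_subset_right inter_subset_right
    · exact absurd (proj_injOn h0 (h ▸ h0 : proj y ≠ 0) h) hxy
  · obtain ⟨U, V, hU, hV, hxU, hyV, hUV⟩ := t2_separation h
    exact ⟨_, _, hU.preimage continuous_proj, hV.preimage continuous_proj, hxU, hyV,
      hUV.preimage proj⟩

/-- A representative of a point of the torus in the box `[-1/2, 1/2]²`. -/
theorem exists_toTorus_eq (x : Torus) :
    ∃ v : ℝ × ℝ, toTorus v = x ∧ |v.1| ≤ 1 / 2 ∧ |v.2| ≤ 1 / 2 := by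
  obtain ⟨v, rfl⟩ := toTorus_surjective x
  refine ⟨(v.1 - round v.1, v.2 - round v.2), ?_, abs_sub_round _, abs_sub_round _⟩
  ext
  · simp [toTorus]
  · simp [toTorus]

theorem toTorus_eq_zero_iff {v : ℝ × ℝ} (h1 : |v.1| < 1) (h2 : |v.2| < 1) :
    toTorus v = 0 ↔ v = 0 := by
  refine ⟨fun h => ?_, fun h => by rw [h, toTorus_zero]⟩
  have key : ∀ s : ℝ, |s| < 1 → (s : UnitAddCircle) = 0 → s = 0 := by
    intro s hs h
    obtain ⟨n, hn⟩ := (AddCircle.coe_eq_zero_iff (1 : ℝ)).1 h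
    have hn' : (n : ℝ) = s := by simpa using hn
    rw [← hn'] at hs
    have : |n| < 1 := by exact_mod_cast hs
    rw [← hn', Int.abs_lt_one_iff.1 this, Int.cast_zero]
  exact Prod.ext (key _ h1 (congrArg Prod.fst h)) (key _ h2 (congrArg Prod.snd h))

theorem continuousOn_mkPoint (d : ℝ × ℝ) (hd : d ≠ 0) :
    ContinuousOn (fun v => mkPoint v d hd) {v | toTorus v ≠ 0} := by
  intro v hv
  set i : ChartIndex := .away (v.1 - 1 / 2, v.2 - 1 / 2)
  have hvi : v ∈ i.domain := by
    refine ⟨?_, ?_, hv⟩ <;> constructor <;> simp only <;> linarith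
  have h : ContinuousAt i.param v :=
    (i.continuousOn_param).continuousAt (i.isOpen_domain.mem_nhds hvi)
  refine (h.congr ?_).continuousWithinAt
  filter_upwards [i.isOpen_domain.mem_nhds hvi] with z hz
  exact (mkPoint_of_ne_zero hz.2.2).trans (mkPoint_of_ne_zero hz.2.2).symm

/-- The blow-up is covered by the images of three compact sets: one in each of the charts that
omit the vertical and the horizontal line, and an annulus around `0` in the plane. -/
instance : CompactSpace BlowUp := by
  set K : Set (ℝ × ℝ) := Icc (-1 / 4) (1 / 4) ×ˢ Icc (-1) 1 with hK
  have hKc : IsCompact K := isCompact_Icc.prod isCompact_Icc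
  have key : ∀ s m : ℝ, s ∈ Icc (-1 / 4 : ℝ) (1 / 4) → m ∈ Icc (-1 : ℝ) 1 → |s * m| ≤ 1 / 4 := by
    intro s m hs hm
    rw [abs_mul]
    have h1 : |s| ≤ 1 / 4 := abs_le.2 ⟨by linarith [hs.1], hs.2⟩
    have h2 : |m| ≤ 1 := abs_le.2 ⟨hm.1, hm.2⟩
    nlinarith [abs_nonneg s, abs_nonneg m]
  set i₁ : ChartIndex := .near (ContinuousLinearEquiv.refl ℝ (ℝ × ℝ)) with hi₁
  set i₂ : ChartIndex := .near (ContinuousLinearEquiv.prodComm ℝ ℝ ℝ) with hi₂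
  have hK₁ : K ⊆ i₁.domain := by
    rintro ⟨s, m⟩ ⟨hs, hm⟩
    obtain ⟨h1, h2⟩ := abs_le.1 (key s m hs hm)
    simp only [hi₁, ChartIndex.domain, ChartIndex.base, mem_ofPred_eq, mem_Ioo] at hs ⊢
    simp only [ContinuousLinearEquiv.coe_refl', id_eq]
    exact ⟨⟨by linarith [hs.1], by linarith [hs.2]⟩, by linarith, by linarith⟩
  have hK₂ : K ⊆ i₂.domain := by
    rintro ⟨s, m⟩ ⟨hs, hm⟩
    obtain ⟨h1, h2⟩ := abs_le.1 (key s m hs hm)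
    simp only [hi₂, ChartIndex.domain, ChartIndex.base, mem_ofPred_eq, mem_Ioo] at hs ⊢
    simp only [ContinuousLinearEquiv.prodComm_apply, Prod.fst_swap, Prod.snd_swap]
    exact ⟨⟨by linarith, by linarith⟩, by linarith [hs.1], by linarith [hs.2]⟩
  set L : Set (ℝ × ℝ) := (Icc (-1 / 2) (1 / 2) ×ˢ Icc (-1 / 2) (1 / 2)) \
    (Ioo (-1 / 4) (1 / 4) ×ˢ Ioo (-1 / 4) (1 / 4)) with hL
  have hLc : IsCompact L :=
    (isCompact_Icc.prod isCompact_Icc).diff (isOpen_Ioo.prod isOpen_Ioo)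
  have hL0 : L ⊆ {v | toTorus v ≠ 0} := by
    rintro v ⟨⟨h1, h2⟩, h3⟩ h0
    rw [toTorus_eq_zero_iff (abs_lt.2 ⟨by linarith [h1.1], by linarith [h1.2]⟩)
      (abs_lt.2 ⟨by linarith [h2.1], by linarith [h2.2]⟩)] at h0
    apply h3
    rw [h0]
    constructor <;> constructor <;> norm_num
  have hd : ((1, 0) : ℝ × ℝ) ≠ 0 := by simp
  have hcover : (univ : Set BlowUp) ⊆
      i₁.param '' K ∪ i₂.param '' K ∪ (fun v => mkPoint v (1, 0) hd) '' L := by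
    intro x _
    cases x with
    | dir l =>
      left
      induction l using Projectivization.ind with
      | h v hv =>
      by_cases h : |v.2| ≤ |v.1|
      · left
        have h1 : v.1 ≠ 0 := by
          intro h1
          rw [h1, abs_zero, abs_nonpos_iff] at h
          exact hv (Prod.ext h1 h)
        refine ⟨(0, v.2 / v.1), ⟨by constructor <;> norm_num, abs_le.1 ?_⟩, ?_⟩
        · rw [abs_div]; exact div_le_one_of_le₀ h (abs_nonneg _)
        · refine param_near_zero _ (c := 1 / v.1) _ ?_
          ext
          · simp [h1]
          · simp; field_simp
      · right
        push Not at h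
        have h1 : v.2 ≠ 0 := by
          intro h1
          rw [h1, abs_zero] at h
          exact absurd h (not_lt.2 (abs_nonneg _))
        refine ⟨(0, v.1 / v.2), ⟨by constructor <;> norm_num, abs_le.1 ?_⟩, ?_⟩
        · rw [abs_div]; exact div_le_one_of_le₀ h.le (abs_nonneg _)
        · refine param_near_zero _ (c := 1 / v.2) _ ?_
          ext
          · simp; field_simp
          · simp [h1]
    | pt x hx =>
      obtain ⟨v, rfl, h1, h2⟩ := exists_toTorus_eq x
      have hbase : ∀ i : ChartIndex, ∀ z, i.base z = v → i.param z = .pt (toTorus v) hx := by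
        rintro i z rfl
        exact mkPoint_of_ne_zero hx
      by_cases h : |v.1| ≤ 1 / 4 ∧ |v.2| ≤ 1 / 4
      · left
        by_cases h' : |v.2| ≤ |v.1|
        · left
          have h0 : v.1 ≠ 0 := by
            intro h0
            rw [h0, abs_zero, abs_nonpos_iff] at h'
            exact hx (by rw [show v = 0 from Prod.ext h0 h', toTorus_zero])
          refine ⟨(v.1, v.2 / v.1), ⟨?_, abs_le.1 ?_⟩, hbase _ _ ?_⟩
          · have := abs_le.1 h.1
            exact ⟨by linarith [this.1], this.2⟩
          · rw [abs_div]; exact div_le_one_of_le₀ h' (abs_nonneg _)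
          · ext <;> simp [hi₁, ChartIndex.base]; field_simp
        · right
          push Not at h'
          have h0 : v.2 ≠ 0 := by
            intro h0
            rw [h0, abs_zero] at h'
            exact absurd h' (not_lt.2 (abs_nonneg _))
          refine ⟨(v.2, v.1 / v.2), ⟨?_, abs_le.1 ?_⟩, hbase _ _ ?_⟩
          · have := abs_le.1 h.2
            exact ⟨by linarith [this.1], this.2⟩
          · rw [abs_div]; exact div_le_one_of_le₀ h'.le (abs_nonneg _)
          · ext <;> simp [hi₂, ChartIndex.base]; field_simp
      · right
        have e1 := abs_le.1 h1
        have e2 := abs_le.1 h2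
        refine ⟨v, ⟨⟨⟨by linarith [e1.1], e1.2⟩, ⟨by linarith [e2.1], e2.2⟩⟩, fun hv => h ?_⟩,
          mkPoint_of_ne_zero hx⟩
        exact ⟨abs_le.2 ⟨by linarith [hv.1.1], hv.1.2.le⟩,
          abs_le.2 ⟨by linarith [hv.2.1], hv.2.2.le⟩⟩
  refine ⟨IsCompact.of_isClosed_subset (((hKc.image_of_continuousOn
    (i₁.continuousOn_param.mono hK₁)).union (hKc.image_of_continuousOn
    (i₂.continuousOn_param.mono hK₂))).union
    (hLc.image_of_continuousOn ((continuousOn_mkPoint _ hd).mono hL0))) isClosed_univ hcover⟩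

instance : SecondCountableTopology BlowUp :=
  ChartedSpace.secondCountable_of_sigmaCompact (ℝ × ℝ) BlowUp

instance : TopologicalSpace.MetrizableSpace BlowUp :=
  TopologicalSpace.metrizableSpace_of_t3_secondCountable BlowUp

instance : PolishSpace BlowUp := by
  let _ := TopologicalSpace.metrizableSpaceMetric BlowUp
  infer_instance

/-! ### Specification for hyperbolic automorphisms of the torus -/

/-- In the linear coordinates `P`, the matrix `A` is diagonal with entries `lam` and `lam⁻¹`. -/
def Diagonalizes (P : (ℝ × ℝ) ≃L[ℝ] (ℝ × ℝ)) (A : Matrix.SpecialLinearGroup (Fin 2) ℤ)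
    (lam : ℝ) : Prop :=
  ∀ z, planeMap A (P z) = P (lam * z.1, lam⁻¹ * z.2)

theorem Diagonalizes.iterate {P : (ℝ × ℝ) ≃L[ℝ] (ℝ × ℝ)}
    {A : Matrix.SpecialLinearGroup (Fin 2) ℤ} {lam : ℝ} (hP : Diagonalizes P A lam) (n : ℕ)
    (z : ℝ × ℝ) : (planeMap A)^[n] (P z) = P (lam ^ n * z.1, lam⁻¹ ^ n * z.2) := by
  induction n with
  | zero => simp
  | succ n ih =>
    rw [Function.iterate_succ_apply', ih, hP]
    congr 2 <;> ring

theorem torusMap_iterate_toTorus (A : Matrix.SpecialLinearGroup (Fin 2) ℤ) (n : ℕ) (u : ℝ × ℝ) :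
    (torusMap A)^[n] (toTorus u) = toTorus ((planeMap A)^[n] u) := by
  induction n with
  | zero => rfl
  | succ n ih => rw [Function.iterate_succ_apply', ih, torusMap_toTorus,
      Function.iterate_succ_apply']

theorem torusMap_iterate_zero (A : Matrix.SpecialLinearGroup (Fin 2) ℤ) (n : ℕ) :
    (torusMap A)^[n] 0 = 0 :=
  Function.iterate_fixed (torusMap_zero A) n

theorem planeMap_iterate_add (A : Matrix.SpecialLinearGroup (Fin 2) ℤ) (n : ℕ) (u d : ℝ × ℝ) :
    (planeMap A)^[n] (u + d) = (planeMap A)^[n] u + (planeMap A)^[n] d := by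
  simp only [← Module.End.pow_apply, map_add]

theorem toTorus_zsmul (n : ℤ) (v : ℝ × ℝ) : toTorus (n • v) = n • toTorus v := by
  simp [toTorus]

theorem dist_toTorus_add_le (u d : ℝ × ℝ) : dist (toTorus (u + d)) (toTorus u) ≤ ‖d‖ := by
  rw [toTorus_add, dist_eq_norm, add_sub_cancel_left]
  have key : ∀ s : ℝ, ‖(s : UnitAddCircle)‖ ≤ |s| := fun s =>
    QuotientAddGroup.norm_mk_le_norm (m := s)
  exact max_le_max (key d.1) (key d.2)

/-- The lattice `ℤ²` has elements whose contracted coordinate is nonzero but arbitrarily small: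
apply iterates of `A` to any lattice element off the expanded eigenline. -/
theorem Diagonalizes.exists_lattice_small {P : (ℝ × ℝ) ≃L[ℝ] (ℝ × ℝ)}
    {A : Matrix.SpecialLinearGroup (Fin 2) ℤ} {lam : ℝ} (hP : Diagonalizes P A lam)
    (hlam : 1 < lam) {δ : ℝ} (hδ : 0 < δ) :
    ∃ g : ℝ × ℝ, toTorus g = 0 ∧ (P.symm g).2 ≠ 0 ∧ |(P.symm g).2| ≤ δ := by
  obtain ⟨k, hk, hk2⟩ : ∃ k : ℝ × ℝ, toTorus k = 0 ∧ (P.symm k).2 ≠ 0 := by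
    by_contra! hcon
    have h1 := hcon (1, 0) (by simp [toTorus])
    have h2 := hcon (0, 1) (by simp [toTorus])
    have h3 : (P.symm (P (0, 1))).2 = 0 := by
      have : P (0, 1) = (P (0, 1)).1 • ((1, 0) : ℝ × ℝ) + (P (0, 1)).2 • ((0, 1) : ℝ × ℝ) := by
        ext <;> simp
      rw [this, map_add, map_smul, map_smul]
      simp [h1, h2]
    simp at h3
  have h0 : 0 < lam := by linarith
  have hlim : Tendsto (fun j : ℕ => lam⁻¹ ^ j * |(P.symm k).2|) atTop (𝓝 0) := by
    simpa using (tendsto_pow_atTop_nhds_zero_of_lt_one (inv_nonneg.2 h0.le)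
      (inv_lt_one_of_one_lt₀ hlam)).mul_const |(P.symm k).2|
  obtain ⟨j, hj⟩ := (hlim.eventually_lt_const hδ).exists
  have hg : P.symm ((planeMap A)^[j] k) = (lam ^ j * (P.symm k).1, lam⁻¹ ^ j * (P.symm k).2) := by
    conv_lhs => rw [← P.apply_symm_apply k, hP.iterate, P.symm_apply_apply]
  refine ⟨(planeMap A)^[j] k, ?_, ?_, ?_⟩
  · rw [← torusMap_iterate_toTorus, hk, torusMap_iterate_zero]
  · rw [hg]
    exact mul_ne_zero (pow_ne_zero _ (inv_ne_zero h0.ne')) hk2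
  · rw [hg, abs_mul, abs_of_pos (pow_pos (inv_pos.2 h0) j)]
    exact hj.le

/-- Every point of the torus has a representative with arbitrarily small contracted coordinate and
uniformly bounded expanded coordinate. This is the form of topological mixing that permits jumping
from one orbit segment to another. -/
theorem Diagonalizes.exists_representative {P : (ℝ × ℝ) ≃L[ℝ] (ℝ × ℝ)}
    {A : Matrix.SpecialLinearGroup (Fin 2) ℤ} {lam : ℝ} (hP : Diagonalizes P A lam)
    (hlam : 1 < lam) {δ : ℝ} (hδ : 0 < δ) :
    ∃ R : ℝ, 0 ≤ R ∧ ∀ x : Torus, ∃ c : ℝ × ℝ,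
      toTorus c = x ∧ |(P.symm c).1| ≤ R ∧ |(P.symm c).2| ≤ δ := by
  obtain ⟨g, hg, hg0, hgδ⟩ := hP.exists_lattice_small hlam hδ
  set B : ℝ := ‖(P.symm : (ℝ × ℝ) →L[ℝ] (ℝ × ℝ))‖ with hB
  have hB0 : 0 ≤ B := norm_nonneg _
  set γ := (P.symm g).2 with hγ
  refine ⟨B + (B / |γ| + 1) * |(P.symm g).1|, by positivity, fun x => ?_⟩
  obtain ⟨u, rfl, hu1, hu2⟩ := exists_toTorus_eq x
  have hu : ‖P.symm u‖ ≤ B := by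
    have h1 : ‖u‖ ≤ 1 := max_le (by rw [Real.norm_eq_abs]; linarith)
      (by rw [Real.norm_eq_abs]; linarith)
    calc ‖P.symm u‖ ≤ B * ‖u‖ := (P.symm : (ℝ × ℝ) →L[ℝ] (ℝ × ℝ)).le_opNorm u
      _ ≤ B := mul_le_of_le_one_right hB0 h1
  have hs : |(P.symm u).1| ≤ B := (le_max_left _ _).trans hu
  have ht : |(P.symm u).2| ≤ B := (le_max_right _ _).trans hu
  -- Subtracting `r` copies of `g` leaves a contracted coordinate of size at most `|γ| / 2`.
  set r : ℤ := round ((P.symm u).2 / γ) with hr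
  have hround := abs_sub_round ((P.symm u).2 / γ)
  have hP1 : P.symm (u + (-r) • g) = P.symm u + (-r) • P.symm g := by rw [map_add, map_zsmul]
  refine ⟨u + (-r) • g, by rw [toTorus_add, toTorus_zsmul, hg]; simp, ?_, ?_⟩
  · have hr' : |(r : ℝ)| ≤ B / |γ| + 1 := by
      have h1 : |(P.symm u).2 / γ| ≤ B / |γ| := by
        rw [abs_div]; gcongr
      have h2 := abs_sub_abs_le_abs_sub (r : ℝ) ((P.symm u).2 / γ)
      rw [abs_sub_comm] at h2
      linarith
    rw [hP1]
    rw [Prod.fst_add, Prod.smul_fst, zsmul_eq_mul, Int.cast_neg]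
    refine (abs_add_le _ _).trans (add_le_add hs ?_)
    rw [abs_mul, abs_neg]
    gcongr
  · rw [hP1]
    rw [Prod.snd_add, Prod.smul_snd, zsmul_eq_mul, Int.cast_neg]
    have : (P.symm u).2 + -(r : ℝ) * γ = ((P.symm u).2 / γ - r) * γ := by
      field_simp; ring
    rw [this, abs_mul]
    nlinarith [abs_nonneg γ]

/-- A contracting system of affine equations along a self-map of a finite index set has a bounded
solution. -/
theorem exists_affine_recurrence {ι : Type*} [Fintype ι] (e : ι → ι) {a C : ℝ} (ha : 0 ≤ a)
    (ha1 : a < 1) (hC : 0 ≤ C) (c : ι → ℝ) (hc : ∀ i, |c i| ≤ C) :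
    ∃ s : ι → ℝ, (∀ i, s i = a * s (e i) + c i) ∧ ∀ i, |s i| ≤ C / (1 - a) := by
  let T : (ι → ℝ) → (ι → ℝ) := fun s i => a * s (e i) + c i
  have hT : ContractingWith ⟨a, ha⟩ T := by
    refine ⟨ha1, LipschitzWith.of_dist_le_mul fun s s' => ?_⟩
    refine (dist_pi_le_iff (by positivity)).2 fun i => ?_
    simp only [T, Real.dist_eq, add_sub_add_right_eq_sub, ← mul_sub, abs_mul, abs_of_nonneg ha]
    exact mul_le_mul_of_nonneg_left (dist_le_pi_dist s s' (e i)) ha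
  set s := hT.fixedPoint with hs
  have hfix : ∀ i, s i = a * s (e i) + c i := fun i => (congrFun hT.fixedPoint_isFixedPt i).symm
  refine ⟨s, hfix, ?_⟩
  have h1 : ‖s‖ ≤ a * ‖s‖ + C := by
    refine (pi_norm_le_iff_of_nonneg (by positivity)).2 fun i => ?_
    rw [hfix i]
    refine (norm_add_le _ _).trans (add_le_add ?_ (hc i))
    rw [norm_mul, Real.norm_of_nonneg ha]
    exact mul_le_mul_of_nonneg_left (norm_le_pi_norm s (e i)) ha
  intro i
  rw [le_div_iff₀ (by linarith)]
  have h2 : |s i| ≤ ‖s‖ := norm_le_pi_norm s i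
  nlinarith

/-- The specification property: orbit segments of arbitrary equal length of finitely many points are
shadowed, in any cyclic order, by the orbits of periodic points, with transition times `M` that
depend only on the precision `δ`. As the map is linear, the deviations from the given segments solve
an affine recurrence, which is contracting forwards in the contracted coordinate and backwards in
the expanded one. -/
theorem Diagonalizes.specification {P : (ℝ × ℝ) ≃L[ℝ] (ℝ × ℝ)}
    {A : Matrix.SpecialLinearGroup (Fin 2) ℤ} {lam : ℝ} (hP : Diagonalizes P A lam)
    (hlam : 1 < lam) {δ : ℝ} (hδ : 0 < δ) :
    ∃ M : ℕ, ∀ (n : ℕ) {ι : Type} [Fintype ι] (σ : Equiv.Perm ι) (x : ι → Torus),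
      ∃ X : ι → Torus, (∀ i, (torusMap A)^[n + M] (X i) = X (σ i)) ∧
        ∀ i, ∀ k ≤ n, dist ((torusMap A)^[k] (X i)) ((torusMap A)^[k] (x i)) ≤ δ := by
  have h0 : 0 < lam := by linarith
  set B : ℝ := ‖(P : (ℝ × ℝ) →L[ℝ] (ℝ × ℝ))‖ with hB
  have hB0 : 0 ≤ B := norm_nonneg _
  set η : ℝ := δ / (2 * (B + 1)) with hη
  have hη0 : 0 < η := by positivity
  obtain ⟨R, hR0, hR⟩ := hP.exists_representative hlam hη0
  have hpow : Tendsto (fun M : ℕ => lam⁻¹ ^ M) atTop (𝓝 0) :=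
    tendsto_pow_atTop_nhds_zero_of_lt_one (inv_nonneg.2 h0.le) (inv_lt_one_of_one_lt₀ hlam)
  obtain ⟨M, hM1, hM2⟩ := ((hpow.eventually_lt_const (show (0 : ℝ) < 1 / 2 by norm_num)).and
    (hpow.eventually_lt_const (show (0 : ℝ) < η / (R + 1) by positivity))).exists
  refine ⟨M, fun n ι _ σ x => ?_⟩
  choose u hu using fun i => toTorus_surjective (x i)
  -- The points `u i + d i` are sought with `A ^ (n + M) (d i) + c i = d (σ i)`, where `c i` is a
  -- representative of the jump from the end of a segment to the beginning of the next one. The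
  -- expanded coordinate of `c i` may be large (up to `R`), but is contracted over the time `M`.
  choose c hc hc1 hc2 using fun i => hR (toTorus ((planeMap A)^[n + M] (u i) - u (σ i)))
  set a : ℝ := lam⁻¹ ^ (n + M) with ha
  have hinv : lam⁻¹ ≤ 1 := (inv_lt_one_of_one_lt₀ hlam).le
  have hinv0 : 0 ≤ lam⁻¹ := inv_nonneg.2 h0.le
  have ha0 : 0 ≤ a := by positivity
  have haM : a ≤ lam⁻¹ ^ M := pow_le_pow_of_le_one hinv0 hinv (by omega)
  have ha1 : a < 1 / 2 := haM.trans_lt hM1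
  have hal : lam ^ (n + M) * a = 1 := by
    rw [ha, ← mul_pow, mul_inv_cancel₀ h0.ne', one_pow]
  obtain ⟨t, ht, htb⟩ := exists_affine_recurrence σ.symm ha0 (by linarith) hη0.le
    (fun i => (P.symm (c (σ.symm i))).2) (fun i => hc2 _)
  obtain ⟨s, hs, hsb⟩ := exists_affine_recurrence (C := a * R) σ ha0 (by linarith) (by positivity)
    (fun i => -(a * (P.symm (c i)).1)) (fun i => by
      rw [abs_neg, abs_mul, abs_of_nonneg ha0]
      exact mul_le_mul_of_nonneg_left (hc1 i) ha0)
  -- deviation from the prescribed segments, with expanded coordinate `s` and contracted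
  -- coordinate `t`
  set d : ι → ℝ × ℝ := fun i => P (s i, t i) with hd
  refine ⟨fun i => toTorus (u i + d i), fun i => ?_, fun i k hk => ?_⟩
  · have hrec : (planeMap A)^[n + M] (d i) = d (σ i) - c i := by
      have h1 : c i = P (P.symm (c i)) := by simp
      rw [hd, h1]
      simp only
      rw [hP.iterate, ← map_sub]
      congr 1
      ext
      · have := hs i
        simp only [Prod.fst_sub]
        rw [this]
        linear_combination (s (σ i) - (P.symm (c i)).1) * hal
      · have := ht (σ i)
        simp only [Equiv.symm_apply_apply] at this
        simp only [Prod.snd_sub]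
        rw [this]
        ring
    change (torusMap A)^[n + M] (toTorus (u i + d i)) = toTorus (u (σ i) + d (σ i))
    rw [torusMap_iterate_toTorus, planeMap_iterate_add, hrec, toTorus_add, toTorus_add,
      toTorus_sub (d (σ i)), hc, toTorus_sub]
    abel
  · rw [← hu i, torusMap_iterate_toTorus, torusMap_iterate_toTorus, planeMap_iterate_add, hd]
    simp only
    rw [hP.iterate]
    refine (dist_toTorus_add_le _ _).trans ?_
    have hhalf : ∀ {D : ℝ}, 0 ≤ D → D / (1 - a) ≤ 2 * D := fun hD => by
      rw [div_le_iff₀ (by linarith)]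
      nlinarith
    have e1 : ‖lam ^ k * s i‖ ≤ 2 * η := by
      rw [norm_mul, Real.norm_of_nonneg (by positivity), Real.norm_eq_abs]
      have h1 : |s i| ≤ 2 * (a * R) := (hsb i).trans (hhalf (by positivity))
      have h2 : lam ^ k * a ≤ lam⁻¹ ^ M := by
        have h3 : lam ^ k ≤ lam ^ n := pow_le_pow_right₀ hlam.le hk
        calc lam ^ k * a ≤ lam ^ n * a := by gcongr
          _ = lam⁻¹ ^ M := by
            rw [ha, pow_add, ← mul_assoc, ← mul_pow, mul_inv_cancel₀ h0.ne', one_pow, one_mul]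
      have h4 : lam⁻¹ ^ M * (R + 1) ≤ η := ((lt_div_iff₀ (by positivity)).1 hM2).le
      have h5 : 0 ≤ lam⁻¹ ^ M := by positivity
      calc lam ^ k * |s i| ≤ lam ^ k * (2 * (a * R)) := by gcongr
        _ = 2 * ((lam ^ k * a) * R) := by ring
        _ ≤ 2 * (lam⁻¹ ^ M * R) := by gcongr
        _ ≤ 2 * η := by nlinarith
    have e2 : ‖lam⁻¹ ^ k * t i‖ ≤ 2 * η := by
      rw [norm_mul, Real.norm_of_nonneg (by positivity), Real.norm_eq_abs]
      exact (mul_le_of_le_one_left (abs_nonneg _) (pow_le_one₀ hinv0 hinv)).trans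
        ((htb i).trans (hhalf hη0.le))
    calc ‖P (lam ^ k * s i, lam⁻¹ ^ k * t i)‖ ≤ B * ‖(lam ^ k * s i, lam⁻¹ ^ k * t i)‖ :=
          (P : (ℝ × ℝ) →L[ℝ] (ℝ × ℝ)).le_opNorm _
      _ ≤ B * (2 * η) := by gcongr; exact max_le e1 e2
      _ ≤ δ := by
        have : η * (2 * (B + 1)) = δ := by rw [hη]; field_simp
        nlinarith

/-! ### Averages along orbits -/

theorem sum_range_mul_iterate {X : Type*} (f : X → X) (x : X) (h : X → ℝ) (N K : ℕ) :
    ∑ k ∈ Finset.range (N * K), h (f^[k] x) =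
      ∑ j ∈ Finset.range K, ∑ k ∈ Finset.range N, h (f^[k] (f^[N * j] x)) := by
  induction K with
  | zero => simp
  | succ K ih =>
    rw [Nat.mul_succ, Finset.sum_range_add, ih, Finset.sum_range_succ]
    congr 1
    refine Finset.sum_congr rfl fun k _ => ?_
    rw [← Function.iterate_add_apply, add_comm k]

/-- The average along a periodic orbit can be computed over any multiple of the period. -/
theorem average_minimalPeriod {X : Type*} (f : X → X) {x : X} {L : ℕ} (hL : 0 < L)
    (hx : f^[L] x = x) (h : X → ℝ) :
    (Function.minimalPeriod f x : ℝ)⁻¹ *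
      ∑ k ∈ Finset.range (Function.minimalPeriod f x), h (f^[k] x) =
    (L : ℝ)⁻¹ * ∑ k ∈ Finset.range L, h (f^[k] x) := by
  have hper : Function.IsPeriodicPt f L x := hx
  obtain ⟨q, hq⟩ := hper.minimalPeriod_dvd
  have hp : 0 < Function.minimalPeriod f x := hper.minimalPeriod_pos hL
  set p := Function.minimalPeriod f x with hpdef
  have hq0 : 0 < q := Nat.pos_of_ne_zero fun h => by simp [hq, h] at hL
  have hfix : ∀ j, f^[p * j] x = x := fun j =>
    (Function.isPeriodicPt_minimalPeriod f x).mul_const j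
  have hsum := sum_range_mul_iterate f x h p q
  simp only [hfix, Finset.sum_const, Finset.card_range, nsmul_eq_mul] at hsum
  rw [hq, hsum]
  push_cast
  field_simp

theorem isProbabilityMeasure_orbitMeasure {f : BlowUp → BlowUp} {x : BlowUp}
    (hx : x ∈ Function.periodicPts f) : IsProbabilityMeasure (orbitMeasure f x) := by
  have hp := Function.minimalPeriod_pos_of_mem_periodicPts hx
  constructor
  simp only [orbitMeasure, Measure.smul_apply, Measure.finsetSum_apply, measure_univ,
    Finset.sum_const, Finset.card_range, nsmul_eq_mul, mul_one, smul_eq_mul]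
  exact ENNReal.inv_mul_cancel (by exact_mod_cast hp.ne') (ENNReal.natCast_ne_top _)

theorem integral_orbitMeasure (f : BlowUp → BlowUp) (x : BlowUp) (h : BlowUp → ℝ) :
    ∫ y, h y ∂(orbitMeasure f x) = (Function.minimalPeriod f x : ℝ)⁻¹ *
      ∑ k ∈ Finset.range (Function.minimalPeriod f x), h (f^[k] x) := by
  rw [orbitMeasure, integral_smul_measure, integral_finsetSum_measure]
  · simp
  · exact fun i _ => integrable_dirac (by simp)

theorem integral_comp_of_measurePreserving {X : Type*} [TopologicalSpace X]
    [MeasurableSpace X] [BorelSpace X] [SecondCountableTopology X] {m : Measure X} {f : X → X}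
    (hf : MeasurePreserving f m m) {g : X → ℝ} (hg : Continuous g) :
    ∫ x, g (f x) ∂m = ∫ x, g x ∂m := by
  conv_rhs => rw [← hf.map_eq]
  exact (integral_map hf.measurable.aemeasurable hg.aestronglyMeasurable).symm

/-- By the law of large numbers, a probability measure is approximated, on finitely many test
functions, by the uniform measures on the initial segments of a sequence; the first term of the
sequence can be prescribed. -/
theorem exists_seq_tendsto_average {X ι : Type*} [MeasurableSpace X] [Finite ι] (m : Measure X)
    [IsProbabilityMeasure m] (g : ι → X → ℝ) (hg : ∀ j, Measurable (g j))
    (hint : ∀ j, Integrable (g j) m) (x₀ : X) :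
    ∃ x : ℕ → X, x 0 = x₀ ∧ ∀ j, Tendsto (fun K : ℕ => (∑ i ∈ Finset.range K, g j (x i)) / K)
      atTop (𝓝 (∫ y, g j y ∂m)) := by
  let Q : Measure (ℕ → X) := Measure.infinitePi fun _ => m
  have heval : ∀ i : ℕ, MeasurePreserving (Function.eval i) Q m :=
    fun i => measurePreserving_eval_infinitePi (fun _ => m) i
  have hLLN : ∀ j, ∀ᵐ ξ ∂Q, Tendsto (fun K : ℕ => (∑ i ∈ Finset.range K, g j (ξ i)) / K)
      atTop (𝓝 (∫ y, g j y ∂m)) := by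
    intro j
    have h := ProbabilityTheory.strong_law_ae_real (μ := Q) (fun i ξ => g j (ξ i))
      ((heval 0).integrable_comp_of_integrable (hint j)) ?_ ?_
    · have h0 : ∫ ξ, g j (ξ 0) ∂Q = ∫ y, g j y ∂m := by
        rw [← (heval 0).map_eq]
        exact (integral_map (heval 0).measurable.aemeasurable
          (hg j).aestronglyMeasurable).symm
      rw [h0] at h
      exact h
    · intro a b hab
      exact (ProbabilityTheory.iIndepFun_infinitePi (X := fun _ => g j) fun _ => hg j).indepFun hab
    · intro i
      refine ⟨((hg j).comp (measurable_pi_apply i)).aemeasurable,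
        ((hg j).comp (measurable_pi_apply 0)).aemeasurable, ?_⟩
      have : ∀ i : ℕ, Q.map (fun ξ => g j (ξ i)) = m.map (g j) := fun i => by
        rw [← (heval i).map_eq, Measure.map_map (hg j) (heval i).measurable]
        rfl
      rw [this, this]
  obtain ⟨ξ, hξ⟩ := (ae_all_iff.2 hLLN).exists
  refine ⟨Function.update ξ 0 x₀, by simp, fun j => ?_⟩
  have h0 : Tendsto (fun K : ℕ => (g j x₀ - g j (ξ 0)) / (K : ℝ)) atTop (𝓝 0) :=
    tendsto_const_div_atTop_nhds_zero_nat _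
  have h1 := (hξ j).add h0
  rw [add_zero] at h1
  refine h1.congr' ?_
  filter_upwards [eventually_gt_atTop 0] with K hK
  obtain ⟨K, rfl⟩ := Nat.exists_eq_succ_of_ne_zero hK.ne'
  rw [← add_div, Finset.sum_range_succ', Finset.sum_range_succ']
  simp only [Function.update_self, ne_eq, Nat.add_eq_zero_iff, one_ne_zero, and_false,
    not_false_eq_true, Function.update_of_ne]
  congr 1
  ring

/-! ### Density of the periodic orbits among the invariant measures of the torus -/

theorem continuous_torusMap (A : Matrix.SpecialLinearGroup (Fin 2) ℤ) :
    Continuous (torusMap A) := by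
  unfold torusMap
  fun_prop

/-- The average of a bounded sequence over `n + M` terms is close to the average over the first `n`
terms of a nearby sequence if `n` is large compared with `M`. -/
theorem abs_sum_block_sub_le {n M : ℕ} (hn : 0 < n) {a b : ℕ → ℝ} {B η : ℝ}
    (ha : ∀ k, |a k| ≤ B) (hb : ∀ k, |b k| ≤ B) (hab : ∀ k < n, |a k - b k| ≤ η) :
    |∑ k ∈ Finset.range (n + M), a k -
      ((n + M : ℕ) : ℝ) * ((n : ℝ)⁻¹ * ∑ k ∈ Finset.range n, b k)| ≤ n * η + 2 * M * B := by
  have hn' : (0 : ℝ) < n := by exact_mod_cast hn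
  have e : ∑ k ∈ Finset.range (n + M), a k -
      ((n + M : ℕ) : ℝ) * ((n : ℝ)⁻¹ * ∑ k ∈ Finset.range n, b k) =
      ∑ k ∈ Finset.range n, (a k - b k) + ∑ k ∈ Finset.range M, a (n + k) -
        M * ((n : ℝ)⁻¹ * ∑ k ∈ Finset.range n, b k) := by
    rw [Finset.sum_range_add, Finset.sum_sub_distrib]
    push_cast
    field_simp
    ring
  have h1 : |∑ k ∈ Finset.range n, (a k - b k)| ≤ n * η := by
    refine (Finset.abs_sum_le_sum_abs _ _).trans ?_
    refine (Finset.sum_le_card_nsmul _ _ η fun k hk => hab k (Finset.mem_range.1 hk)).trans ?_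
    simp
  have h2 : |∑ k ∈ Finset.range M, a (n + k)| ≤ M * B := by
    refine (Finset.abs_sum_le_sum_abs _ _).trans ?_
    refine (Finset.sum_le_card_nsmul _ _ B fun k _ => ha _).trans ?_
    simp
  have h3 : |(M : ℝ) * ((n : ℝ)⁻¹ * ∑ k ∈ Finset.range n, b k)| ≤ M * B := by
    rw [abs_mul, Nat.abs_cast, abs_mul, abs_of_pos (inv_pos.2 hn')]
    refine mul_le_mul_of_nonneg_left ?_ (Nat.cast_nonneg _)
    rw [inv_mul_le_iff₀ hn']
    refine (Finset.abs_sum_le_sum_abs _ _).trans ?_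
    refine (Finset.sum_le_card_nsmul _ _ B fun k _ => hb _).trans ?_
    simp
  rw [e]
  refine (abs_sub _ _).trans ?_
  have := abs_add_le (∑ k ∈ Finset.range n, (a k - b k)) (∑ k ∈ Finset.range M, a (n + k))
  linarith

/-- An invariant measure of the torus is approximated, on finitely many test functions, by the
orbit of a nonzero periodic point: shadow the orbit segments of a finite sample of the measure. One
segment that starts far from `0` is added, so that the periodic point is not `0`. -/
theorem Diagonalizes.exists_periodic_average {P : (ℝ × ℝ) ≃L[ℝ] (ℝ × ℝ)}
    {A : Matrix.SpecialLinearGroup (Fin 2) ℤ} {lam : ℝ} (hP : Diagonalizes P A lam)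
    (hlam : 1 < lam) (m : Measure Torus) [IsProbabilityMeasure m]
    (hm : MeasurePreserving (torusMap A) m m) (F : Finset (BoundedContinuousFunction Torus ℝ))
    {ε : ℝ} (hε : 0 < ε) :
    ∃ y : Torus, y ≠ 0 ∧ ∃ L : ℕ, 0 < L ∧ (torusMap A)^[L] y = y ∧ ∀ g ∈ F,
      |(L : ℝ)⁻¹ * ∑ k ∈ Finset.range L, g ((torusMap A)^[k] y) - ∫ z, g z ∂m| < ε := by
  set f := torusMap A with hf
  have hfc : ∀ k, Continuous f^[k] := (continuous_torusMap A).iterate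
  obtain ⟨B, hB0, hB⟩ : ∃ B : ℝ, 0 ≤ B ∧ ∀ g ∈ F, ∀ z, |g z| ≤ B := by
    refine ⟨∑ g ∈ F, ‖g‖, by positivity, fun g hg z => (g.norm_coe_le_norm z).trans ?_⟩
    exact Finset.single_le_sum (f := fun g : BoundedContinuousFunction Torus ℝ => ‖g‖)
      (fun g _ => norm_nonneg g) hg
  obtain ⟨δ, hδ0, hδ1, hδ⟩ : ∃ δ : ℝ, 0 < δ ∧ δ < 1 / 2 ∧
      ∀ g ∈ F, ∀ y z, dist y z ≤ δ → |g y - g z| ≤ ε / 4 := by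
    have hex : ∀ g : BoundedContinuousFunction Torus ℝ,
        ∀ᶠ δ in 𝓝[>] (0 : ℝ), ∀ y z, dist y z ≤ δ → |g y - g z| ≤ ε / 4 := by
      intro g
      obtain ⟨δ, hδ, h⟩ := Metric.uniformContinuous_iff.1
        (CompactSpace.uniformContinuous_of_continuous g.continuous) (ε / 4) (by positivity)
      filter_upwards [Ioo_mem_nhdsGT hδ] with η hη y z hyz
      exact (h (hyz.trans_lt hη.2)).le
    obtain ⟨δ, h1, h2⟩ := (((Finset.eventually_all F).2 fun g _ => hex g).and
      (Ioo_mem_nhdsGT (show (0 : ℝ) < 1 / 2 by norm_num))).exists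
    exact ⟨δ, h2.1, h2.2, h1⟩
  obtain ⟨M, hM⟩ := hP.specification hlam hδ0
  -- The segments are long compared with the transition time `M`, which depends on `δ` only.
  obtain ⟨n, hn0, hn⟩ : ∃ n : ℕ, 0 < n ∧ 2 * M * B ≤ n * (ε / 4) := by
    obtain ⟨n, hn⟩ := exists_nat_ge (2 * M * B / (ε / 4))
    refine ⟨n + 1, n.succ_pos, ?_⟩
    rw [div_le_iff₀ (by positivity)] at hn
    push_cast
    nlinarith
  -- the average of `g` along the orbit segment of length `n`
  let H : BoundedContinuousFunction Torus ℝ → Torus → ℝ :=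
    fun g z => (n : ℝ)⁻¹ * ∑ k ∈ Finset.range n, g (f^[k] z)
  have hHc : ∀ g, Continuous (H g) := fun g =>
    continuous_const.mul (continuous_finsetSum _ fun k _ => g.continuous.comp (hfc k))
  have hintc : ∀ h : Torus → ℝ, Continuous h → Integrable h m := fun h hh =>
    (BoundedContinuousFunction.mkOfCompact ⟨h, hh⟩).integrable m
  have hHint : ∀ g, ∫ z, H g z ∂m = ∫ z, g z ∂m := by
    intro g
    have hn' : (n : ℝ) ≠ 0 := by exact_mod_cast hn0.ne'
    simp only [H]
    rw [integral_const_mul, integral_finsetSum (f := fun k z => g (f^[k] z)) _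
      fun k _ => hintc _ (g.continuous.comp (hfc k)),
      Finset.sum_congr rfl fun k _ =>
        integral_comp_of_measurePreserving (hm.iterate k) g.continuous]
    simp only [Finset.sum_const, Finset.card_range, nsmul_eq_mul]
    field_simp
  obtain ⟨x, hx0, hx⟩ := exists_seq_tendsto_average m (fun g : F => H g)
    (fun g => (hHc g).measurable) (fun g => hintc _ (hHc g)) (toTorus (1 / 2, 1 / 2))
  obtain ⟨K, hK0, hK⟩ : ∃ K : ℕ, 0 < K ∧ ∀ g ∈ F,
      |(∑ i ∈ Finset.range K, H g (x i)) / K - ∫ z, g z ∂m| < ε / 4 := by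
    have h1 : ∀ g : F, ∀ᶠ K : ℕ in atTop,
        |(∑ i ∈ Finset.range K, H g (x i)) / K - ∫ z, g.1 z ∂m| < ε / 4 := by
      intro g
      have := Metric.tendsto_nhds.1 (hx g) (ε / 4) (by positivity)
      simpa only [Real.dist_eq, hHint] using this
    obtain ⟨K, h2, h3⟩ := ((eventually_all.2 h1).and (eventually_gt_atTop 0)).exists
    exact ⟨K, h3, fun g hg => h2 ⟨g, hg⟩⟩
  have : NeZero K := ⟨hK0.ne'⟩
  obtain ⟨X, hX1, hX2⟩ := hM n (Equiv.addRight (1 : ZMod K)) (fun i => x i.val)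
  have hXit : ∀ j : ℕ, f^[(n + M) * j] (X 0) = X (j : ZMod K) := by
    intro j
    induction j with
    | zero => simp
    | succ j ih =>
      rw [Nat.mul_succ, add_comm ((n + M) * j), Function.iterate_add_apply, ih]
      simpa using hX1 (j : ZMod K)
  refine ⟨X 0, fun h0 => ?_, (n + M) * K, by positivity, by simpa using hXit K, fun g hg => ?_⟩
  · have h1 := hX2 0 0 (Nat.zero_le _)
    simp only [Function.iterate_zero, id_eq, h0, ZMod.val_zero, hx0] at h1
    have h2 : ‖((1 / 2 : ℝ) : UnitAddCircle)‖ = 1 / 2 := by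
      rw [(AddCircle.norm_coe_eq_abs_iff (1 : ℝ) one_ne_zero).2 (by norm_num [abs_of_pos])]
      norm_num [abs_of_pos]
    have h3 : ‖((1 / 2 : ℝ) : UnitAddCircle)‖ ≤ dist (0 : Torus) (toTorus (1 / 2, 1 / 2)) := by
      rw [dist_zero_left]
      exact le_max_left _ _
    linarith
  · have hblock : ∀ j ∈ Finset.range K, |∑ k ∈ Finset.range (n + M), g (f^[k] (X (j : ZMod K))) -
        ((n + M : ℕ) : ℝ) * H g (x j)| ≤ ((n + M : ℕ) : ℝ) * (ε / 2) := by
      intro j hj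
      have hval : (j : ZMod K).val = j := ZMod.val_cast_of_lt (Finset.mem_range.1 hj)
      refine (abs_sum_block_sub_le hn0 (fun k => hB g hg _) (fun k => hB g hg _)
        (η := ε / 4) fun k hk => hδ g hg _ _ ?_).trans ?_
      · have := hX2 (j : ZMod K) k hk.le
        rwa [hval] at this
      · push_cast
        have : 0 ≤ (M : ℝ) * ε := by positivity
        nlinarith
    have hN0 : (0 : ℝ) < ((n + M : ℕ) : ℝ) := by exact_mod_cast (by omega : 0 < n + M)
    have hK0' : (0 : ℝ) < K := by exact_mod_cast hK0
    have hsum : |∑ k ∈ Finset.range ((n + M) * K), g (f^[k] (X 0)) -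
        ((n + M : ℕ) : ℝ) * ∑ j ∈ Finset.range K, H g (x j)| ≤
          K * (((n + M : ℕ) : ℝ) * (ε / 2)) := by
      rw [sum_range_mul_iterate, Finset.mul_sum, ← Finset.sum_sub_distrib]
      refine (Finset.abs_sum_le_sum_abs _ _).trans ?_
      refine (Finset.sum_le_card_nsmul _ _ (((n + M : ℕ) : ℝ) * (ε / 2))
        fun j hj => ?_).trans (by simp)
      rw [hXit]
      exact hblock j hj
    have hK' := hK g hg
    set S := ∑ k ∈ Finset.range ((n + M) * K), g (f^[k] (X 0))
    set T := ∑ j ∈ Finset.range K, H g (x j)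
    have e : (((n + M) * K : ℕ) : ℝ)⁻¹ * S - T / K =
        (S - ((n + M : ℕ) : ℝ) * T) / (((n + M : ℕ) : ℝ) * K) := by
      rw [Nat.cast_mul]
      field_simp
    have h1 : |(((n + M) * K : ℕ) : ℝ)⁻¹ * S - T / K| ≤ ε / 2 := by
      rw [e, abs_div, abs_of_pos (mul_pos hN0 hK0'), div_le_iff₀ (mul_pos hN0 hK0')]
      linarith
    have h2 := abs_add_le ((((n + M) * K : ℕ) : ℝ)⁻¹ * S - T / K) (T / K - ∫ z, g z ∂m)
    rw [sub_add_sub_cancel] at h2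
    linarith

/-! ### Approximation on the blow-up -/

/-- The measures equidistributed on the periodic orbits off the exceptional fibre. -/
def periodicMeasures (A : Matrix.SpecialLinearGroup (Fin 2) ℤ) :
    Set (ProbabilityMeasure BlowUp) :=
  {ν | ∃ x ∈ Function.periodicPts (lift A), proj x ≠ 0 ∧
    (ν : Measure BlowUp) = orbitMeasure (lift A) x}

theorem proj_iterate_lift (A : Matrix.SpecialLinearGroup (Fin 2) ℤ) (k : ℕ) (x : BlowUp) :
    proj ((lift A)^[k] x) = (torusMap A)^[k] (proj x) := by
  induction k with
  | zero => rfl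
  | succ k ih => rw [Function.iterate_succ_apply', proj_lift, ih, Function.iterate_succ_apply']

theorem torusMap_iterate_ne_zero (A : Matrix.SpecialLinearGroup (Fin 2) ℤ) (k : ℕ) {y : Torus}
    (hy : y ≠ 0) : (torusMap A)^[k] y ≠ 0 := by
  induction k with
  | zero => exact hy
  | succ k ih => rw [Function.iterate_succ_apply']; exact torusMap_ne_zero A ih

/-- Every invariant measure of the torus is a limit of projections of periodic orbits of the blow-up
off the exceptional fibre. -/
theorem Diagonalizes.mem_closure_map_proj {P : (ℝ × ℝ) ≃L[ℝ] (ℝ × ℝ)}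
    {A : Matrix.SpecialLinearGroup (Fin 2) ℤ} {lam : ℝ} (hP : Diagonalizes P A lam)
    (hlam : 1 < lam) (m : ProbabilityMeasure Torus)
    (hm : MeasurePreserving (torusMap A) (m : Measure Torus) (m : Measure Torus)) :
    m ∈ closure ((fun ν : ProbabilityMeasure BlowUp => ν.map continuous_proj.aemeasurable) ''
      periodicMeasures A) := by
  classical
  -- The approximating measures form a net indexed by finite sets of test functions and precisions.
  have key : ∀ i : Finset (BoundedContinuousFunction Torus ℝ) × ℕ,
      ∃ ν ∈ periodicMeasures A, ∀ g ∈ i.1,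
        |∫ z, g z ∂(ν.map continuous_proj.aemeasurable : Measure Torus) -
          ∫ z, g z ∂(m : Measure Torus)| < 1 / ((i.2 : ℝ) + 1) := by
    rintro ⟨F, j⟩
    obtain ⟨y, hy, L, hL, hyL, hF⟩ := hP.exists_periodic_average hlam (m : Measure Torus) hm F
      (ε := 1 / ((j : ℝ) + 1)) (by positivity)
    have hx : (lift A)^[L] (.pt y hy) = .pt y hy := by
      refine proj_injOn ?_ ?_ ?_
      · change proj _ ≠ 0
        rw [proj_iterate_lift]
        exact torusMap_iterate_ne_zero A L hy
      · exact hy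
      · rw [proj_iterate_lift]
        exact hyL
    have hper : BlowUp.pt y hy ∈ Function.periodicPts (lift A) := ⟨L, hL, hx⟩
    obtain ⟨ν, hν⟩ : ∃ ν : ProbabilityMeasure BlowUp,
        (ν : Measure BlowUp) = orbitMeasure (lift A) (.pt y hy) :=
      ⟨⟨_, isProbabilityMeasure_orbitMeasure hper⟩, rfl⟩
    refine ⟨ν, ⟨_, hper, hy, hν⟩, fun g hg => ?_⟩
    rw [ProbabilityMeasure.toMeasure_map, integral_map continuous_proj.aemeasurable
      g.continuous.aestronglyMeasurable, hν, integral_orbitMeasure,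
      average_minimalPeriod _ hL hx (fun x => g (proj x))]
    simp only [proj_iterate_lift]
    exact hF g hg
  choose ν hν hνF using key
  refine mem_closure_of_tendsto (f := fun i => (ν i).map continuous_proj.aemeasurable)
    (b := atTop) ?_ (Eventually.of_forall fun i => mem_image_of_mem _ (hν i))
  rw [ProbabilityMeasure.tendsto_iff_forall_integral_tendsto]
  intro g
  rw [Metric.tendsto_nhds]
  intro ε hε
  obtain ⟨j, hj⟩ := exists_nat_one_div_lt hε
  filter_upwards [eventually_ge_atTop (({g}, j) : Finset (BoundedContinuousFunction Torus ℝ) × ℕ)]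
    with i hi
  refine (hνF i g (hi.1 (Finset.mem_singleton_self g))).trans_le (le_trans ?_ hj.le)
  have : (j : ℝ) ≤ i.2 := by exact_mod_cast hi.2
  exact one_div_le_one_div_of_le (by positivity) (by linarith)

/-! ### The growth cocycle -/

/-- The squared Euclidean norm of the plane. -/
def planeSq (v : ℝ × ℝ) : ℝ := v.1 ^ 2 + v.2 ^ 2

/-- The squared Euclidean distance of a point of the torus from `0`. -/
noncomputable def torusSq (x : Torus) : ℝ := ‖x.1‖ ^ 2 + ‖x.2‖ ^ 2

theorem planeSq_pos {v : ℝ × ℝ} (hv : v ≠ 0) : 0 < planeSq v := by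
  unfold planeSq
  by_cases h : v.1 = 0
  · have h2 : v.2 ≠ 0 := fun h2 => hv (Prod.ext h h2)
    positivity
  · positivity

theorem planeSq_smul (c : ℝ) (v : ℝ × ℝ) : planeSq (c • v) = c ^ 2 * planeSq v := by
  simp [planeSq]
  ring

theorem continuous_planeSq : Continuous planeSq := by
  unfold planeSq
  fun_prop

theorem torusSq_pos {x : Torus} (hx : x ≠ 0) : 0 < torusSq x := by
  unfold torusSq
  by_cases h : x.1 = 0
  · have h2 : x.2 ≠ 0 := fun h2 => hx (Prod.ext h h2)
    have := norm_pos_iff.2 h2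
    positivity
  · have := norm_pos_iff.2 h
    positivity

theorem continuous_torusSq : Continuous torusSq := by
  unfold torusSq
  fun_prop

theorem torusSq_toTorus {v : ℝ × ℝ} (h1 : |v.1| ≤ 1 / 2) (h2 : |v.2| ≤ 1 / 2) :
    torusSq (toTorus v) = planeSq v := by
  have key : ∀ s : ℝ, |s| ≤ 1 / 2 → ‖(s : UnitAddCircle)‖ = |s| := fun s hs =>
    (AddCircle.norm_coe_eq_abs_iff (1 : ℝ) one_ne_zero).2 (by simpa using hs)
  simp [torusSq, toTorus, planeSq, key _ h1, key _ h2]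

/-- The logarithmic growth, under `A`, of the squared distance from `0`; on the exceptional fibre,
the logarithmic growth of the squared norm on the given line. -/
noncomputable def growth (A : Matrix.SpecialLinearGroup (Fin 2) ℤ) : BlowUp → ℝ
  | .pt x _ => Real.log (torusSq (torusMap A x)) - Real.log (torusSq x)
  | .dir l => Real.log (planeSq (planeMap A l.rep)) - Real.log (planeSq l.rep)

theorem planeMap_ne_zero (A : Matrix.SpecialLinearGroup (Fin 2) ℤ) {d : ℝ × ℝ} (hd : d ≠ 0) :
    planeMap A d ≠ 0 := by
  simpa using (planeMap_injective A).ne hd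

theorem log_planeSq_smul {c : ℝ} (hc : c ≠ 0) {d : ℝ × ℝ} (hd : d ≠ 0) :
    Real.log (planeSq (c • d)) = Real.log (c ^ 2) + Real.log (planeSq d) := by
  rw [planeSq_smul, Real.log_mul (pow_ne_zero 2 hc) (planeSq_pos hd).ne']

theorem growth_dir_mk (A : Matrix.SpecialLinearGroup (Fin 2) ℤ) {d : ℝ × ℝ} (hd : d ≠ 0) :
    growth A (.dir (Projectivization.mk ℝ d hd)) =
      Real.log (planeSq (planeMap A d)) - Real.log (planeSq d) := by
  obtain ⟨c, hc⟩ := Projectivization.exists_smul_eq_mk_rep ℝ d hd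
  have hc' : (Projectivization.mk ℝ d hd).rep = (c : ℝ) • d := by rw [← hc]; rfl
  simp only [growth]
  rw [hc', map_smul, log_planeSq_smul c.ne_zero hd, log_planeSq_smul c.ne_zero
    (planeMap_ne_zero A hd)]
  ring

theorem growth_of_proj_ne_zero (A : Matrix.SpecialLinearGroup (Fin 2) ℤ) {x : BlowUp}
    (hx : proj x ≠ 0) : growth A x =
      Real.log (torusSq (proj (lift A x))) - Real.log (torusSq (proj x)) := by
  cases x with
  | pt x hx => rfl
  | dir l => exact absurd rfl hx

/-- The growth cocycle extends continuously to the exceptional fibre, since the growth of the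
distance from `0` under a linear map depends on the direction only. -/
theorem continuous_growth (A : Matrix.SpecialLinearGroup (Fin 2) ℤ) : Continuous (growth A) := by
  refine continuous_of_param fun i z hz => ?_
  have hAc : Continuous (planeMap A) := (ChartIndex.contDiff_planeMap A).continuous
  have hbc := i.contDiff_base.continuous
  by_cases h0 : toTorus (i.base z) = 0
  · cases i with
    | away a => exact absurd h0 hz.2.2
    | near P =>
    have hz1 := ChartIndex.near_fst_eq_zero hz h0
    have hP0 : P ((0, 0) : ℝ × ℝ) = 0 := map_zero P
    have hb0 : (ChartIndex.near P).base z = 0 := by simp [ChartIndex.base, hz1, hP0]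
    have hPne : ∀ m, P (1, m) ≠ 0 := fun m => ChartIndex.slope_ne_zero (.near P) (0, m)
    have hsmall : ∀ G : ℝ × ℝ → ℝ × ℝ, Continuous G → G z = 0 →
        ∀ᶠ y in 𝓝 z, |(G y).1| < 1 / 2 ∧ |(G y).2| < 1 / 2 := by
      intro G hG hGz
      have h1 : Tendsto (fun y => |(G y).1|) (𝓝 z) (𝓝 0) := by
        simpa [hGz] using (continuous_fst.comp hG).abs.tendsto z
      have h2 : Tendsto (fun y => |(G y).2|) (𝓝 z) (𝓝 0) := by
        simpa [hGz] using (continuous_snd.comp hG).abs.tendsto z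
      exact (h1.eventually_lt_const (by norm_num)).and (h2.eventually_lt_const (by norm_num))
    have hcont : ContinuousAt (fun y : ℝ × ℝ => Real.log (planeSq (planeMap A (P (1, y.2)))) -
        Real.log (planeSq (P (1, y.2)))) z := by
      have hd : Continuous fun y : ℝ × ℝ => P (1, y.2) := by fun_prop
      refine ContinuousAt.sub (ContinuousAt.log ?_ ?_) (ContinuousAt.log ?_ ?_)
      · exact (continuous_planeSq.comp (hAc.comp hd)).continuousAt
      · exact (planeSq_pos (planeMap_ne_zero A (hPne _))).ne'
      · exact (continuous_planeSq.comp hd).continuousAt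
      · exact (planeSq_pos (hPne _)).ne'
    refine hcont.congr ?_
    filter_upwards [hsmall _ hbc hb0, hsmall _ (hAc.comp hbc) (by simp [hb0])] with y hy1 hy2
    rw [Function.comp_apply] at hy2
    have hbase : (ChartIndex.near P).base y = y.1 • P (1, y.2) := by
      rw [← map_smul]; simp [ChartIndex.base]
    by_cases hy0 : toTorus ((ChartIndex.near P).base y) = 0
    · have : (ChartIndex.near P).param y = .dir (Projectivization.mk ℝ (P (1, y.2)) (hPne _)) :=
        mkPoint_of_eq_zero hy0
      rw [this, growth_dir_mk]
    · have hy1' : y.1 ≠ 0 := fun h => hy0 (by rw [hbase, h, zero_smul, toTorus_zero])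
      have hproj := (ChartIndex.near P).proj_param y
      rw [growth_of_proj_ne_zero A (by rw [hproj]; exact hy0), proj_lift, hproj,
        torusMap_toTorus, torusSq_toTorus hy1.1.le hy1.2.le,
        torusSq_toTorus hy2.1.le hy2.2.le, hbase, map_smul, log_planeSq_smul hy1' (hPne _),
        log_planeSq_smul hy1' (planeMap_ne_zero A (hPne _))]
      ring
  · have hc1 : Continuous fun y => torusSq (toTorus (i.base y)) :=
      continuous_torusSq.comp (continuous_toTorus.comp hbc)
    have hc2 : Continuous fun y => torusSq (torusMap A (toTorus (i.base y))) :=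
      continuous_torusSq.comp ((continuous_torusMap A).comp (continuous_toTorus.comp hbc))
    have hcont : ContinuousAt (fun y => Real.log (torusSq (torusMap A (toTorus (i.base y)))) -
        Real.log (torusSq (toTorus (i.base y)))) z :=
      ContinuousAt.sub (hc2.continuousAt.log (torusSq_pos (torusMap_ne_zero A h0)).ne')
        (hc1.continuousAt.log (torusSq_pos h0).ne')
    refine hcont.congr ?_
    have hev : ∀ᶠ y in 𝓝 z, toTorus (i.base y) ≠ 0 :=
      (continuous_toTorus.comp hbc).continuousAt.eventually_ne h0
    filter_upwards [hev] with y hy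
    rw [growth_of_proj_ne_zero A (by rw [i.proj_param]; exact hy), proj_lift, i.proj_param]

/-- A bounded coboundary of a measurable, possibly non-integrable, function has integral zero with
respect to every finite invariant measure: truncate the function. -/
theorem integral_eq_zero_of_coboundary {X : Type*} [MeasurableSpace X] {ν : Measure X}
    [IsFiniteMeasure ν] {f : X → X} (hf : MeasurePreserving f ν ν) {g φ : X → ℝ}
    (hg : Measurable g) (hφ : ∀ᵐ x ∂ν, φ x = g (f x) - g x) {B : ℝ}
    (hB : ∀ᵐ x ∂ν, |φ x| ≤ B) : ∫ x, φ x ∂ν = 0 := by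
  let c : ℕ → ℝ → ℝ := fun N t => max (min t N) (-N)
  have hcm : ∀ N, Measurable (c N) := fun N => by
    have : Continuous (c N) := by fun_prop
    exact this.measurable
  have hcb : ∀ N t, ‖c N t‖ ≤ N := fun N t => by
    have : (0 : ℝ) ≤ N := N.cast_nonneg
    exact abs_le.2 ⟨le_max_right _ _, max_le (min_le_right _ _) (by linarith)⟩
  have hcl : ∀ N s t, |c N s - c N t| ≤ |s - t| := fun N s t =>
    (abs_max_sub_max_le_abs _ _ _).trans (abs_inf_sub_inf_le_abs _ _ _)
  have hint : ∀ N, Integrable (fun x => c N (g x)) ν := fun N =>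
    Integrable.of_bound ((hcm N).comp hg).aestronglyMeasurable N
      (Eventually.of_forall fun x => hcb N _)
  have hzero : ∀ N, ∫ x, (c N (g (f x)) - c N (g x)) ∂ν = 0 := by
    intro N
    have h1 : ∫ x, c N (g (f x)) ∂ν = ∫ x, c N (g x) ∂ν := by
      conv_rhs => rw [← hf.map_eq]
      exact (integral_map hf.measurable.aemeasurable
        ((hcm N).comp hg).aestronglyMeasurable).symm
    have h2 : Integrable (fun x => c N (g (f x))) ν := hf.integrable_comp_of_integrable (hint N)
    rw [integral_sub h2 (hint N), h1, sub_self]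
  have hlim : Tendsto (fun N => ∫ x, (c N (g (f x)) - c N (g x)) ∂ν) atTop
      (𝓝 (∫ x, φ x ∂ν)) := by
    refine tendsto_integral_of_dominated_convergence (fun _ => B) (fun N => ?_)
      (integrable_const B) (fun N => ?_) ?_
    · exact (((hcm N).comp (hg.comp hf.measurable)).sub
        ((hcm N).comp hg)).aestronglyMeasurable
    · filter_upwards [hφ, hB] with x h1 h2
      refine (hcl N _ _).trans ?_
      rwa [← h1]
    · filter_upwards [hφ] with x h1
      rw [h1]
      have hev : ∀ t : ℝ, ∀ᶠ N : ℕ in atTop, c N t = t := by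
        intro t
        obtain ⟨N₀, hN₀⟩ := exists_nat_ge |t|
        filter_upwards [eventually_ge_atTop N₀] with N hN
        have h2 : |t| ≤ N := hN₀.trans (by exact_mod_cast hN)
        simp only [c]
        rw [min_eq_left (abs_le.1 h2).2, max_eq_left (abs_le.1 h2).1]
      refine tendsto_const_nhds.congr' ?_
      filter_upwards [hev (g (f x)), hev (g x)] with N h2 h3
      rw [h2, h3]
  exact tendsto_nhds_unique hlim (by simp [hzero])

/-! ### Invariant measures on the exceptional fibre -/

/-- The exceptional fibre. -/
def fibre : Set BlowUp := proj ⁻¹' {0}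

theorem measurableSet_fibre : MeasurableSet fibre :=
  (isClosed_singleton.preimage continuous_proj).measurableSet

theorem lift_preimage_fibre (A : Matrix.SpecialLinearGroup (Fin 2) ℤ) :
    lift A ⁻¹' fibre = fibre := by
  ext x
  simp only [fibre, mem_preimage, mem_singleton_iff, proj_lift]
  exact ⟨fun h => by_contra fun h' => torusMap_ne_zero A h' h,
    fun h => by rw [h, torusMap_zero]⟩

/-- The point of the exceptional fibre in the direction of the first axis of the coordinates `P`. -/
noncomputable def axisOne (P : (ℝ × ℝ) ≃L[ℝ] (ℝ × ℝ)) : BlowUp :=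
  .dir (Projectivization.mk ℝ (P (1, 0)) (by simp))

/-- The point of the exceptional fibre in the direction of the second axis of the
coordinates `P`. -/
noncomputable def axisTwo (P : (ℝ × ℝ) ≃L[ℝ] (ℝ × ℝ)) : BlowUp :=
  .dir (Projectivization.mk ℝ (P (0, 1)) (by simp))

theorem axisOne_ne_axisTwo (P : (ℝ × ℝ) ≃L[ℝ] (ℝ × ℝ)) : axisOne P ≠ axisTwo P := by
  intro h
  obtain ⟨c, hc⟩ := (Projectivization.mk_eq_mk_iff' ℝ _ _ _ _).1 (BlowUp.dir.inj h)
  rw [← map_smul] at hc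
  have := congrArg Prod.fst (P.injective hc)
  simp at this

theorem eq_axisTwo_or_eq_param (P : (ℝ × ℝ) ≃L[ℝ] (ℝ × ℝ)) {x : BlowUp} (hx : x ∈ fibre) :
    x = axisTwo P ∨ ∃ m : ℝ, x = (ChartIndex.near P).param (0, m) := by
  obtain ⟨l, rfl⟩ := proj_eq_zero_iff.1 hx
  induction l using Projectivization.ind with
  | h d hd =>
  by_cases h : (P.symm d).1 = 0
  · left
    refine congrArg BlowUp.dir ((Projectivization.mk_eq_mk_iff' ℝ _ _ _ _).2
      ⟨(P.symm d).2, ?_⟩)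
    rw [← map_smul, ← P.symm.injective.eq_iff, P.symm_apply_apply]
    ext <;> simp [h]
  · right
    refine ⟨(P.symm d).2 / (P.symm d).1, (param_near_zero P (c := 1 / (P.symm d).1) hd ?_).symm⟩
    rw [← P.symm.injective.eq_iff, P.symm_apply_apply, map_smul]
    ext
    · simp [h]
    · simp; field_simp

section Diagonalizes

variable {P : (ℝ × ℝ) ≃L[ℝ] (ℝ × ℝ)} {A : Matrix.SpecialLinearGroup (Fin 2) ℤ} {lam : ℝ}

theorem Diagonalizes.lift_param_zero (hP : Diagonalizes P A lam) (hlam : 1 < lam) (m : ℝ) :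
    lift A ((ChartIndex.near P).param (0, m)) =
      (ChartIndex.near P).param (0, lam⁻¹ ^ 2 * m) := by
  have h0 : lam ≠ 0 := by linarith
  have hne : P (1, m) ≠ 0 := ChartIndex.slope_ne_zero (.near P) (0, m)
  rw [param_near_zero P (c := 1) hne (one_smul _ _)]
  refine (param_near_zero P (c := lam⁻¹) (planeMap_ne_zero A hne) ?_).symm
  rw [hP, ← map_smul]
  congr 1
  ext
  · simp [h0]
  · simp; ring

theorem Diagonalizes.lift_axisOne (hP : Diagonalizes P A lam) (hlam : 1 < lam) :
    lift A (axisOne P) = axisOne P := by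
  have h : axisOne P = (ChartIndex.near P).param (0, 0) :=
    (param_near_zero P (c := 1) _ (one_smul _ _)).symm
  rw [h, hP.lift_param_zero hlam, mul_zero]

theorem Diagonalizes.lift_axisTwo (hP : Diagonalizes P A lam) :
    lift A (axisTwo P) = axisTwo P := by
  refine congrArg BlowUp.dir ((Projectivization.mk_eq_mk_iff' ℝ _ _ _ _).2 ⟨lam⁻¹, ?_⟩)
  rw [hP, ← map_smul]
  congr 1
  ext <;> simp

theorem Diagonalizes.growth_axisOne (hP : Diagonalizes P A lam) (hlam : 1 < lam) :
    growth A (axisOne P) = 2 * Real.log lam := by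
  have h0 : lam ≠ 0 := by linarith
  have h1 : planeMap A (P (1, 0)) = lam • P (1, 0) := by
    rw [hP, ← map_smul]; congr 1; ext <;> simp
  rw [axisOne, growth_dir_mk, h1, log_planeSq_smul h0 (by simp), add_sub_cancel_right,
    Real.log_pow, Nat.cast_ofNat]

theorem Diagonalizes.growth_axisTwo (hP : Diagonalizes P A lam) (hlam : 1 < lam) :
    growth A (axisTwo P) = -(2 * Real.log lam) := by
  have h0 : lam ≠ 0 := by linarith
  have h1 : planeMap A (P (0, 1)) = lam⁻¹ • P (0, 1) := by
    rw [hP, ← map_smul]; congr 1; ext <;> simp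
  rw [axisTwo, growth_dir_mk, h1, log_planeSq_smul (inv_ne_zero h0) (by simp),
    add_sub_cancel_right, Real.log_pow, Nat.cast_ofNat, Real.log_inv, mul_neg]

/-- An invariant measure gives no mass to the exceptional fibre minus the two fixed points: on the
fibre, the function `1 / (1 + m²)` of the slope `m` increases strictly along the other orbits. -/
theorem Diagonalizes.ae_fibre (hP : Diagonalizes P A lam) (hlam : 1 < lam)
    {μ : Measure BlowUp} [IsFiniteMeasure μ] (hμ : MeasurePreserving (lift A) μ μ) :
    (fibre : Set BlowUp) =ᵐ[μ] ({axisOne P, axisTwo P} : Set BlowUp) := by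
  classical
  set i : ChartIndex := .near P with hi
  set h : BlowUp → ℝ := (i.homeo.source).piecewise (fun x => 1 / (1 + (i.homeo x).2 ^ 2))
    (fun _ => 0) with hh
  have hmeas : Measurable h := by
    refine ContinuousOn.measurable_piecewise ?_ continuousOn_const i.homeo.open_source.measurableSet
    refine ContinuousOn.div continuousOn_const ?_ fun x _ => by positivity
    exact continuousOn_const.add ((continuous_snd.comp_continuousOn i.homeo.continuousOn).pow 2)
  have hval : ∀ m : ℝ, h (i.param (0, m)) = 1 / (1 + m ^ 2) := by
    intro m
    have hm := mem_domain_near_zero P m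
    have : i.param (0, m) ∈ i.homeo.source := ⟨_, hm, rfl⟩
    rw [hh, piecewise_eq_of_mem _ _ _ this, i.homeo_param hm]
  have hbound : ∀ x, ‖h x‖ ≤ 1 := by
    intro x
    by_cases hx : x ∈ i.homeo.source
    · rw [hh, piecewise_eq_of_mem _ _ _ hx, Real.norm_of_nonneg (by positivity)]
      exact div_le_one_of_le₀ (by nlinarith [sq_nonneg (i.homeo x).2]) (by positivity)
    · rw [hh, piecewise_eq_of_notMem _ _ _ hx]
      simp
  set ν := μ.restrict fibre with hν
  have hinv : MeasurePreserving (lift A) ν ν := by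
    have := hμ.restrict_preimage measurableSet_fibre
    rwa [lift_preimage_fibre] at this
  have hint : Integrable h ν := Integrable.of_bound hmeas.aestronglyMeasurable 1
    (Eventually.of_forall hbound)
  have hint' : Integrable (fun x => h (lift A x) - h x) ν :=
    (hinv.integrable_comp_of_integrable hint).sub hint
  have hzero : ∫ x, (h (lift A x) - h x) ∂ν = 0 := by
    refine integral_eq_zero_of_coboundary hinv hmeas (Eventually.of_forall fun x => rfl) (B := 2)
      (Eventually.of_forall fun x => ?_)
    refine (abs_sub _ _).trans ?_
    have h1 := hbound (lift A x)
    have h2 := hbound x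
    rw [Real.norm_eq_abs] at h1 h2
    linarith
  have hl0 : 0 < lam⁻¹ := inv_pos.2 (by linarith)
  have hl1 : lam⁻¹ < 1 := inv_lt_one_of_one_lt₀ hlam
  have hl2 : (lam⁻¹ ^ 2) ^ 2 < 1 := pow_lt_one₀ (by positivity)
    (pow_lt_one₀ hl0.le hl1 two_ne_zero) two_ne_zero
  have hcmp : ∀ x ∈ fibre, 0 ≤ h (lift A x) - h x ∧
      (h (lift A x) - h x = 0 → x = axisOne P ∨ x = axisTwo P) := by
    intro x hx
    rcases eq_axisTwo_or_eq_param P hx with rfl | ⟨m, rfl⟩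
    · rw [hP.lift_axisTwo]
      simp
    · rw [hP.lift_param_zero hlam, hval, hval, mul_pow]
      have h1 : (lam⁻¹ ^ 2) ^ 2 * m ^ 2 ≤ m ^ 2 :=
        mul_le_of_le_one_left (sq_nonneg m) hl2.le
      refine ⟨sub_nonneg.2 (one_div_le_one_div_of_le (by positivity) (by linarith)), fun h => ?_⟩
      left
      have h2 : m = 0 := by
        rw [sub_eq_zero, one_div, one_div, inv_inj] at h
        have h3 : (1 - (lam⁻¹ ^ 2) ^ 2) * m ^ 2 = 0 := by linarith
        rcases mul_eq_zero.1 h3 with h3 | h3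
        · linarith
        · exact pow_eq_zero_iff two_ne_zero |>.1 h3
      rw [h2]
      exact param_near_zero P (c := 1) _ (one_smul _ _)
  have hmem : ∀ᵐ x ∂ν, x ∈ fibre := ae_restrict_mem measurableSet_fibre
  have hae : (fun x => h (lift A x) - h x) =ᵐ[ν] 0 :=
    (integral_eq_zero_iff_of_nonneg_ae (hmem.mono fun x hx => (hcmp x hx).1) hint').1 hzero
  have hae' : ∀ᵐ x ∂μ, x ∈ fibre → x = axisOne P ∨ x = axisTwo P := by
    rw [← ae_restrict_iff' measurableSet_fibre]
    filter_upwards [hae, hmem] with x h1 h2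
    exact (hcmp x h2).2 h1
  rw [eventuallyEq_set]
  filter_upwards [hae'] with x hx
  refine ⟨hx, ?_⟩
  rintro (rfl | rfl) <;> rfl

/-- The growth cocycle has integral zero off the exceptional fibre, as a coboundary there. Hence its
integral compares the masses of the two fixed points on the fibre. -/
theorem Diagonalizes.integral_growth (hP : Diagonalizes P A lam) (hlam : 1 < lam)
    {μ : Measure BlowUp} [IsFiniteMeasure μ] (hμ : MeasurePreserving (lift A) μ μ) :
    ∫ x, growth A x ∂μ =
      2 * Real.log lam * (μ.real {axisOne P} - μ.real {axisTwo P}) := by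
  let φ : BoundedContinuousFunction BlowUp ℝ :=
    BoundedContinuousFunction.mkOfCompact ⟨growth A, continuous_growth A⟩
  have hint : Integrable (growth A) μ := φ.integrable μ
  have hoff : ∫ x in fibreᶜ, growth A x ∂μ = 0 := by
    have hinv : MeasurePreserving (lift A) (μ.restrict fibreᶜ) (μ.restrict fibreᶜ) := by
      have := hμ.restrict_preimage measurableSet_fibre.compl
      rwa [preimage_compl, lift_preimage_fibre] at this
    refine integral_eq_zero_of_coboundary hinv
      (g := fun x => Real.log (torusSq (proj x))) ?_ ?_ (B := ‖φ‖)
      (Eventually.of_forall fun x => φ.norm_coe_le_norm x)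
    · exact (continuous_torusSq.comp continuous_proj).measurable.log
    · filter_upwards [ae_restrict_mem measurableSet_fibre.compl] with x hx
      exact growth_of_proj_ne_zero A hx
  rw [← integral_add_compl measurableSet_fibre hint, hoff, add_zero,
    setIntegral_congr_set (hP.ae_fibre hlam hμ), insert_eq,
    setIntegral_union (by simpa using axisOne_ne_axisTwo P) (measurableSet_singleton _)
      hint.integrableOn hint.integrableOn, integral_singleton, integral_singleton,
    hP.growth_axisOne hlam, hP.growth_axisTwo hlam]
  simp only [smul_eq_mul]
  ring

end Diagonalizes

/-! ### Lyapunov exponents of the periodic orbits off the exceptional fibre -/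

/-- Off the exceptional fibre the blow-down is a local diffeomorphism. -/
theorem ChartIndex.bijective_fderiv_base (i : ChartIndex) {z : ℝ × ℝ}
    (hz : toTorus (i.base z) ≠ 0) : Function.Bijective (fderiv ℝ i.base z) := by
  obtain ⟨s, hs, hsz, hev⟩ := i.exists_section hz
  have hb : DifferentiableAt ℝ i.base z := i.contDiff_base.contDiffAt.differentiableAt (by simp)
  have hsd : DifferentiableAt ℝ s (i.base z) := hs.differentiableAt (by simp)
  have hb' : HasFDerivAt i.base (fderiv ℝ i.base z) (s (i.base z)) := by
    rw [hsz]; exact hb.hasFDerivAt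
  have h1 := hb'.comp (i.base z) hsd.hasFDerivAt
  have h2 : HasFDerivAt (i.base ∘ s) (ContinuousLinearMap.id ℝ (ℝ × ℝ)) (i.base z) :=
    (hasFDerivAt_id _).congr_of_eventuallyEq hev
  have h3 := h1.unique h2
  have hsurj : Function.Surjective (fderiv ℝ i.base z).toLinearMap := fun y =>
    ⟨fderiv ℝ s (i.base z) y, DFunLike.congr_fun h3 y⟩
  exact ⟨LinearMap.injective_iff_surjective.2 hsurj, hsurj⟩

/-- In a chart, the blow-down `base` conjugates the lift to the linear map up to a lattice
translation, which is locally constant and so does not affect the derivative. -/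
theorem fderiv_base_comp (A : Matrix.SpecialLinearGroup (Fin 2) ℤ) (i : ChartIndex) (n : ℕ)
    {φ : ℝ × ℝ → ℝ × ℝ} {z : ℝ × ℝ} (hφ : DifferentiableAt ℝ φ z) (hz : φ z = z)
    (h : ∀ᶠ y in 𝓝 z, i.param (φ y) = (lift A)^[n] (i.param y)) (d : ℝ × ℝ) :
    fderiv ℝ i.base z (fderiv ℝ φ z d) = (planeMap A)^[n] (fderiv ℝ i.base z d) := by
  let Λ : (ℝ × ℝ) →L[ℝ] (ℝ × ℝ) := LinearMap.toContinuousLinearMap (planeMap A ^ n)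
  have hΛ : ∀ y, Λ y = (planeMap A)^[n] y := fun y => Module.End.pow_apply _ _ _
  have hb : DifferentiableAt ℝ i.base z := i.contDiff_base.contDiffAt.differentiableAt (by simp)
  have hbc := i.contDiff_base.continuous
  let D : ℝ × ℝ → ℝ × ℝ := fun y => i.base (φ y) - Λ (i.base y)
  have hDc : ContinuousAt D z :=
    (hbc.continuousAt.comp hφ.continuousAt).sub (Λ.continuous.comp hbc).continuousAt
  have hD0 : ∀ᶠ y in 𝓝 z, toTorus (D y) = 0 := by
    filter_upwards [h] with y hy
    have := congrArg proj hy
    rw [i.proj_param, proj_iterate_lift, i.proj_param, torusMap_iterate_toTorus] at this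
    rw [toTorus_sub, hΛ, this, sub_self]
  have hDz : toTorus (D z) = 0 := hD0.self_of_nhds
  have hconst : ∀ᶠ y in 𝓝 z, D y = D z := by
    have hD : Tendsto (fun y => D y - D z) (𝓝 z) (𝓝 0) := by
      have := hDc.tendsto.sub_const (D z)
      rwa [sub_self] at this
    have h1 : Tendsto (fun y => |(D y - D z).1|) (𝓝 z) (𝓝 |(0 : ℝ × ℝ).1|) :=
      (continuous_fst.abs.tendsto (0 : ℝ × ℝ)).comp hD
    have h2 : Tendsto (fun y => |(D y - D z).2|) (𝓝 z) (𝓝 |(0 : ℝ × ℝ).2|) :=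
      (continuous_snd.abs.tendsto (0 : ℝ × ℝ)).comp hD
    rw [Prod.fst_zero, abs_zero] at h1
    rw [Prod.snd_zero, abs_zero] at h2
    filter_upwards [hD0, h1.eventually_lt_const one_pos, h2.eventually_lt_const one_pos]
      with y hy hy1 hy2
    exact sub_eq_zero.1 ((toTorus_eq_zero_iff hy1 hy2).1 (by rw [toTorus_sub, hy, hDz, sub_self]))
  have hb' : HasFDerivAt i.base (fderiv ℝ i.base z) (φ z) := by
    rw [hz]; exact hb.hasFDerivAt
  have e1 : HasFDerivAt D ((fderiv ℝ i.base z).comp (fderiv ℝ φ z) -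
      Λ.comp (fderiv ℝ i.base z)) z :=
    (hb'.comp z hφ.hasFDerivAt).sub (Λ.hasFDerivAt.comp z hb.hasFDerivAt)
  have e2 : HasFDerivAt D (0 : (ℝ × ℝ) →L[ℝ] (ℝ × ℝ)) z :=
    (hasFDerivAt_const (D z) z).congr_of_eventuallyEq hconst
  have e3 := DFunLike.congr_fun (e1.unique e2) d
  rw [← hΛ]
  exact sub_eq_zero.1 e3

/-- The derivative of the first return map at a periodic point, read in a chart. -/
theorem exists_periodDeriv_eq (A : Matrix.SpecialLinearGroup (Fin 2) ℤ) (x : BlowUp) :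
    ∃ i : ChartIndex, ∃ z, i.param z = x ∧ ∃ φ : ℝ × ℝ → ℝ × ℝ, DifferentiableAt ℝ φ z ∧ φ z = z ∧
      (∀ᶠ y in 𝓝 z, i.param (φ y) =
        (lift A)^[Function.minimalPeriod (lift A) x] (i.param y)) ∧
      periodDeriv (lift A) x = (fderiv ℝ φ z).toLinearMap := by
  obtain ⟨i, hi⟩ := exists_index (chart_mem_atlas (ℝ × ℝ) x)
  set e := chartAt (ℝ × ℝ) x with he
  have hes : e.source = i.param '' i.domain := congrArg PartialEquiv.source hi
  have hec : ∀ y, e y = i.chart y := fun y => congrFun (congrArg PartialEquiv.toFun hi) y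
  have hei : ∀ z, e.symm z = i.param z := fun z => congrFun (congrArg PartialEquiv.invFun hi) z
  set n := Function.minimalPeriod (lift A) x with hn
  set F := (lift A)^[n] with hF
  have hFx : F x = x := Function.isPeriodicPt_minimalPeriod (lift A) x
  have hFs : ContMDiff 𝓘(ℝ, ℝ × ℝ) 𝓘(ℝ, ℝ × ℝ) ω F := by
    rw [hF]
    induction n with
    | zero => exact contMDiff_id
    | succ n ih => rw [Function.iterate_succ]; exact ih.comp (contMDiff_lift A)
  have hFd : MDifferentiableAt 𝓘(ℝ, ℝ × ℝ) 𝓘(ℝ, ℝ × ℝ) F x :=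
    hFs.mdifferentiableAt (by simp)
  have hxs : x ∈ e.source := mem_chart_source (ℝ × ℝ) x
  have hsymm : e.symm (e x) = x := e.left_inv hxs
  have hwritten : writtenInExtChartAt 𝓘(ℝ, ℝ × ℝ) 𝓘(ℝ, ℝ × ℝ) x F =
      fun z => e (F (e.symm z)) := by
    ext1 z
    simp [writtenInExtChartAt, hFx, he]
  refine ⟨i, e x, by rw [← hei, hsymm], fun z => e (F (e.symm z)), ?_, ?_, ?_, ?_⟩
  · have := (mdifferentiableAt_iff _ _).1 hFd |>.2
    rw [hwritten] at this
    simp only [modelWithCornersSelf_coe, range_id, differentiableWithinAt_univ] at this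
    exact this
  · simp only [hsymm, hFx]
  · have hcont : ContinuousAt (fun z => F (e.symm z)) (e x) := by
      refine ContinuousAt.comp ?_ (e.continuousAt_symm (e.map_source hxs))
      exact hFs.continuous.continuousAt
    have hmem : ∀ᶠ z in 𝓝 (e x), F (e.symm z) ∈ e.source :=
      hcont.eventually (e.open_source.mem_nhds (by simpa only [hsymm, hFx] using hxs))
    filter_upwards [hmem] with z hz
    rw [← hei, e.left_inv hz, hei]
  · have h1 := hFd.mfderiv
    rw [hwritten] at h1
    simp only [modelWithCornersSelf_coe, range_id, fderivWithin_univ] at h1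
    exact congrArg (fun T : (ℝ × ℝ) →L[ℝ] (ℝ × ℝ) => T.toLinearMap) h1

theorem charpoly_diagonal (a b : ℝ) (T : (ℝ × ℝ) →ₗ[ℝ] (ℝ × ℝ))
    (hT : ∀ z, T z = (a * z.1, b * z.2)) :
    T.charpoly = (Polynomial.X - Polynomial.C a) * (Polynomial.X - Polynomial.C b) := by
  have h : LinearMap.toMatrix (Module.Basis.finTwoProd ℝ) (Module.Basis.finTwoProd ℝ) T =
      !![a, 0; 0, b] := by
    ext i j
    fin_cases i <;> fin_cases j <;> simp [LinearMap.toMatrix_apply, hT]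
  rw [← LinearMap.charpoly_toMatrix T (Module.Basis.finTwoProd ℝ), h, Matrix.charpoly_fin_two]
  simp [Matrix.trace_fin_two, Matrix.det_fin_two]
  ring

theorem Diagonalizes.lyapunovExponents_eq {P : (ℝ × ℝ) ≃L[ℝ] (ℝ × ℝ)}
    {A : Matrix.SpecialLinearGroup (Fin 2) ℤ} {lam : ℝ} (hP : Diagonalizes P A lam)
    (hlam : 1 < lam) {x : BlowUp} (hx : x ∈ Function.periodicPts (lift A)) (hx0 : proj x ≠ 0) :
    lyapunovExponents (lift A) x = {Real.log lam, -Real.log lam} := by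
  obtain ⟨i, z, rfl, φ, hφ, hφz, hφev, hderiv⟩ := exists_periodDeriv_eq A x
  set n := Function.minimalPeriod (lift A) (i.param z) with hn
  have hn0 : 0 < n := Function.minimalPeriod_pos_of_mem_periodicPts hx
  have hn' : (n : ℝ) ≠ 0 := by exact_mod_cast hn0.ne'
  have hl0 : 0 < lam := by linarith
  set T := periodDeriv (lift A) (i.param z) with hT
  have hbij := i.bijective_fderiv_base (z := z) (by rwa [← i.proj_param])
  -- the linear change of coordinates that makes the derivative diagonal
  let E : (ℝ × ℝ) ≃ₗ[ℝ] (ℝ × ℝ) :=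
    (LinearEquiv.ofBijective (fderiv ℝ i.base z).toLinearMap hbij).trans P.symm.toLinearEquiv
  have hE : ∀ d, P (E d) = fderiv ℝ i.base z d := fun d => P.apply_symm_apply _
  have hconj : ∀ y, E.conj T y = (lam ^ n * y.1, lam⁻¹ ^ n * y.2) := by
    intro y
    obtain ⟨d, rfl⟩ := E.surjective y
    rw [LinearEquiv.conj_apply_apply, E.symm_apply_apply]
    apply P.injective
    rw [hE, ← hP.iterate, hE, hderiv]
    exact fderiv_base_comp A i n hφ hφz hφev d
  have hchar : T.charpoly = (Polynomial.X - Polynomial.C (lam ^ n)) *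
      (Polynomial.X - Polynomial.C (lam⁻¹ ^ n)) := by
    rw [← E.charpoly_conj T, charpoly_diagonal _ _ _ hconj]
  have hroots : (T.charpoly.map (algebraMap ℝ ℂ)).roots =
      {algebraMap ℝ ℂ (lam ^ n), algebraMap ℝ ℂ (lam⁻¹ ^ n)} := by
    rw [hchar, Polynomial.map_mul, Polynomial.map_sub, Polynomial.map_sub, Polynomial.map_X,
      Polynomial.map_C, Polynomial.map_C, Polynomial.roots_mul
        (mul_ne_zero (Polynomial.X_sub_C_ne_zero _) (Polynomial.X_sub_C_ne_zero _)),
      Polynomial.roots_X_sub_C, Polynomial.roots_X_sub_C]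
    rfl
  have hlog : ∀ t : ℝ, 0 < t → Real.log ‖algebraMap ℝ ℂ (t ^ n)‖ / n = Real.log t := by
    intro t ht
    rw [norm_algebraMap', Real.norm_of_nonneg (by positivity), Real.log_pow]
    field_simp
  rw [lyapunovExponents, ← hT, hroots, ← hn]
  simp only [Multiset.insert_eq_cons, Multiset.map_cons, Multiset.map_singleton]
  rw [hlog _ hl0, hlog _ (inv_pos.2 hl0), Real.log_inv]

/-! ### Ergodic measures -/

theorem lift_injective (A : Matrix.SpecialLinearGroup (Fin 2) ℤ) : Function.Injective (lift A) :=
  Function.LeftInverse.injective (lift_inv A)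

theorem orbitMeasure_apply (f : BlowUp → BlowUp) (x : BlowUp) (s : Set BlowUp) :
    orbitMeasure f x s = (Function.minimalPeriod f x : ENNReal)⁻¹ *
      ∑ k ∈ Finset.range (Function.minimalPeriod f x), Measure.dirac (f^[k] x) s := by
  rw [orbitMeasure, Measure.smul_apply, Measure.finsetSum_apply, smul_eq_mul]

theorem orbitMeasure_eq_zero {f : BlowUp → BlowUp} {x : BlowUp} {s : Set BlowUp}
    (hs : MeasurableSet s) (h : ∀ k, f^[k] x ∉ s) : orbitMeasure f x s = 0 := by
  rw [orbitMeasure_apply, Finset.sum_eq_zero, mul_zero]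
  intro k _
  rw [Measure.dirac_apply' _ hs, indicator_of_notMem (h k)]

theorem ergodic_orbitMeasure {f : BlowUp → BlowUp} (hf : Measurable f) {x : BlowUp}
    (hx : x ∈ Function.periodicPts f) : Ergodic f (orbitMeasure f x) := by
  have hinv : MeasurePreserving f (orbitMeasure f x) (orbitMeasure f x) := by
    refine ⟨hf, Measure.ext fun s hs => ?_⟩
    rw [Measure.map_apply hf hs, orbitMeasure_apply, orbitMeasure_apply]
    congr 1
    have hp := Function.minimalPeriod_pos_of_mem_periodicPts hx
    have hfix : f^[Function.minimalPeriod f x] x = x := Function.isPeriodicPt_minimalPeriod f x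
    obtain ⟨q, hq⟩ := Nat.exists_eq_succ_of_ne_zero hp.ne'
    rw [hq] at hfix ⊢
    have hstep : ∀ k, Measure.dirac (f^[k] x) (f ⁻¹' s) = Measure.dirac (f^[k + 1] x) s := by
      intro k
      rw [Measure.dirac_apply' _ (hf hs), Measure.dirac_apply' _ hs, Function.iterate_succ_apply']
      rfl
    simp only [hstep]
    rw [Finset.sum_range_succ, Finset.sum_range_succ' (fun k => Measure.dirac (f^[k] x) s)]
    rw [Nat.succ_eq_add_one] at hfix
    rw [hfix]
    rfl
  refine ⟨hinv, ⟨fun s hs hfs => ?_⟩⟩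
  have hiff : ∀ k, f^[k] x ∈ s ↔ x ∈ s := by
    intro k
    induction k with
    | zero => rfl
    | succ k ih => rw [Function.iterate_succ_apply', ← ih, ← mem_preimage, hfs]
  rw [eventuallyConst_set]
  by_cases h : x ∈ s
  · left
    refine orbitMeasure_eq_zero hs.compl fun k hk => hk ((hiff k).2 h)
  · right
    refine orbitMeasure_eq_zero hs.compl.compl fun k hk => h ((hiff k).1 (not_not.1 hk))

theorem orbitMeasure_eq_dirac {f : BlowUp → BlowUp} {p : BlowUp} (hp : f p = p) :
    orbitMeasure f p = Measure.dirac p := by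
  have h : Function.minimalPeriod f p = 1 := Function.minimalPeriod_eq_one_iff_isFixedPt.2 hp
  simp [orbitMeasure, h]

theorem ergodic_dirac {f : BlowUp → BlowUp} (hf : Measurable f) {p : BlowUp} (hp : f p = p) :
    Ergodic f (Measure.dirac p) := by
  rw [← orbitMeasure_eq_dirac hp]
  exact ergodic_orbitMeasure hf ⟨1, one_pos, hp⟩

theorem eq_dirac_of_singleton_eq_one {ν : Measure BlowUp} [IsProbabilityMeasure ν] {p : BlowUp}
    (h : ν {p} = 1) : ν = Measure.dirac p := by
  have hae : ∀ᵐ y ∂ν, y ∈ ({p} : Set BlowUp) :=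
    (prob_compl_eq_zero_iff (measurableSet_singleton p)).2 h
  rw [← Measure.restrict_eq_self_of_ae_mem hae, Measure.restrict_singleton, h, one_smul]

theorem singleton_eq_zero_or_eq_dirac (A : Matrix.SpecialLinearGroup (Fin 2) ℤ)
    {ν : Measure BlowUp} [IsProbabilityMeasure ν] (hν : Ergodic (lift A) ν) {p : BlowUp}
    (hp : lift A p = p) : ν {p} = 0 ∨ ν = Measure.dirac p := by
  have hpre : lift A ⁻¹' {p} = {p} := by
    ext y
    refine ⟨fun h => lift_injective A (by rw [hp]; exact h), fun h => ?_⟩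
    rw [mem_singleton_iff.1 h]
    exact hp
  exact (hν.toPreErgodic.prob_eq_zero_or_one (measurableSet_singleton p) hpre).imp_right
    eq_dirac_of_singleton_eq_one

/-- The growth cocycle as a bounded continuous function. -/
noncomputable def growthBCF (A : Matrix.SpecialLinearGroup (Fin 2) ℤ) :
    BoundedContinuousFunction BlowUp ℝ :=
  BoundedContinuousFunction.mkOfCompact ⟨growth A, continuous_growth A⟩

theorem continuous_integral_growth (A : Matrix.SpecialLinearGroup (Fin 2) ℤ) :
    Continuous fun ν : ProbabilityMeasure BlowUp => ∫ x, growth A x ∂(ν : Measure BlowUp) :=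
  ProbabilityMeasure.continuous_integral_boundedContinuousFunction (growthBCF A)

theorem isClosed_setOf_measurePreserving (A : Matrix.SpecialLinearGroup (Fin 2) ℤ) :
    IsClosed {ν : ProbabilityMeasure BlowUp |
      MeasurePreserving (lift A) (ν : Measure BlowUp) (ν : Measure BlowUp)} := by
  have hc := continuous_lift A
  have h : {ν : ProbabilityMeasure BlowUp |
      MeasurePreserving (lift A) (ν : Measure BlowUp) (ν : Measure BlowUp)} =
      {ν | ν.map hc.aemeasurable = ν} := by
    ext ν
    refine ⟨fun h => Subtype.ext h.map_eq, fun h => ⟨hc.measurable, ?_⟩⟩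
    exact congrArg (fun ν : ProbabilityMeasure BlowUp => (ν : Measure BlowUp)) h
  rw [h]
  exact isClosed_eq (ProbabilityMeasure.continuous_map hc) continuous_id

theorem ergodic_of_mem_periodicMeasures {A : Matrix.SpecialLinearGroup (Fin 2) ℤ}
    {ν : ProbabilityMeasure BlowUp} (hν : ν ∈ periodicMeasures A) :
    Ergodic (lift A) (ν : Measure BlowUp) := by
  obtain ⟨x, hx, -, h⟩ := hν
  rw [h]
  exact ergodic_orbitMeasure (continuous_lift A).measurable hx

theorem periodicMeasures_fibre {A : Matrix.SpecialLinearGroup (Fin 2) ℤ}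
    {ν : ProbabilityMeasure BlowUp} (hν : ν ∈ periodicMeasures A) :
    (ν : Measure BlowUp) fibre = 0 := by
  obtain ⟨x, -, hx0, h⟩ := hν
  rw [h]
  refine orbitMeasure_eq_zero measurableSet_fibre fun k hk => ?_
  have : proj ((lift A)^[k] x) = 0 := hk
  rw [proj_iterate_lift] at this
  exact torusMap_iterate_ne_zero A k hx0 this

section Diagonalizes

variable {P : (ℝ × ℝ) ≃L[ℝ] (ℝ × ℝ)} {A : Matrix.SpecialLinearGroup (Fin 2) ℤ} {lam : ℝ}

theorem Diagonalizes.eq_dirac_of_integral_growth_pos (hP : Diagonalizes P A lam)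
    (hlam : 1 < lam) {ν : Measure BlowUp} [IsProbabilityMeasure ν] (hν : Ergodic (lift A) ν)
    (h : 0 < ∫ x, growth A x ∂ν) : ν = Measure.dirac (axisOne P) := by
  refine (singleton_eq_zero_or_eq_dirac A hν (hP.lift_axisOne hlam)).resolve_left fun h0 => ?_
  rw [hP.integral_growth hlam hν.toMeasurePreserving, measureReal_def, h0,
    ENNReal.toReal_zero, zero_sub] at h
  have := Real.log_pos hlam
  have h2 : 0 ≤ ν.real {axisTwo P} := measureReal_nonneg
  nlinarith [mul_nonneg this.le h2]

theorem Diagonalizes.eq_dirac_of_integral_growth_neg (hP : Diagonalizes P A lam)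
    (hlam : 1 < lam) {ν : Measure BlowUp} [IsProbabilityMeasure ν] (hν : Ergodic (lift A) ν)
    (h : ∫ x, growth A x ∂ν < 0) : ν = Measure.dirac (axisTwo P) := by
  refine (singleton_eq_zero_or_eq_dirac A hν hP.lift_axisTwo).resolve_left fun h0 => ?_
  rw [hP.integral_growth hlam hν.toMeasurePreserving, measureReal_def (s := {axisTwo P}), h0,
    ENNReal.toReal_zero, sub_zero] at h
  have := Real.log_pos hlam
  have h2 : 0 ≤ ν.real {axisOne P} := measureReal_nonneg
  nlinarith [mul_nonneg this.le h2]

/-- A sequence of ergodic measures whose limit gives the two fixed points on the exceptional fibre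
different masses is eventually constant, equal to the Dirac measure at one of these points. -/
theorem Diagonalizes.eventually_eq_of_tendsto (hP : Diagonalizes P A lam) (hlam : 1 < lam)
    {μ : ProbabilityMeasure BlowUp}
    (hμ : MeasurePreserving (lift A) (μ : Measure BlowUp) (μ : Measure BlowUp))
    (hne : (μ : Measure BlowUp) {axisOne P} ≠ (μ : Measure BlowUp) {axisTwo P})
    {ν : ℕ → ProbabilityMeasure BlowUp} (hν : ∀ n, Ergodic (lift A) (ν n : Measure BlowUp))
    (hlim : Tendsto ν atTop (𝓝 μ)) :
    (∀ᶠ n in atTop, ν n = μ) ∧ ((μ : Measure BlowUp) = Measure.dirac (axisOne P) ∨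
      (μ : Measure BlowUp) = Measure.dirac (axisTwo P)) := by
  have hI := (continuous_integral_growth A).continuousAt.tendsto.comp hlim
  have hfinish : ∀ p, (∀ᶠ n in atTop, (ν n : Measure BlowUp) = Measure.dirac p) →
      (∀ᶠ n in atTop, ν n = μ) ∧ (μ : Measure BlowUp) = Measure.dirac p := by
    intro p hp
    let d : ProbabilityMeasure BlowUp := ⟨Measure.dirac p, inferInstance⟩
    have hd : ∀ᶠ n in atTop, ν n = d := hp.mono fun n hn => Subtype.ext hn
    have hμd : μ = d :=
      tendsto_nhds_unique hlim (tendsto_const_nhds.congr' (hd.mono fun n hn => hn.symm))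
    rw [hμd]
    exact ⟨hd, rfl⟩
  rcases lt_trichotomy (∫ x, growth A x ∂(μ : Measure BlowUp)) 0 with h | h | h
  · obtain ⟨h1, h2⟩ := hfinish _ ((hI.eventually_lt_const h).mono fun n hn =>
      hP.eq_dirac_of_integral_growth_neg hlam (hν n) hn)
    exact ⟨h1, Or.inr h2⟩
  · rw [hP.integral_growth hlam hμ] at h
    have := Real.log_pos hlam
    have h' : (μ : Measure BlowUp).real {axisOne P} = (μ : Measure BlowUp).real {axisTwo P} :=
      sub_eq_zero.1 ((mul_eq_zero.1 h).resolve_left (by positivity))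
    exact absurd ((ENNReal.toReal_eq_toReal_iff' (measure_ne_top _ _) (measure_ne_top _ _)).1 h')
      hne
  · obtain ⟨h1, h2⟩ := hfinish _ ((hI.eventually_const_lt h).mono fun n hn =>
      hP.eq_dirac_of_integral_growth_pos hlam (hν n) hn)
    exact ⟨h1, Or.inl h2⟩

/-! ### Density of the periodic orbits on the blow-up -/

theorem Diagonalizes.restrict_fibre (hP : Diagonalizes P A lam) (hlam : 1 < lam)
    {μ : Measure BlowUp} [IsFiniteMeasure μ] (hμ : MeasurePreserving (lift A) μ μ) :
    μ.restrict fibre = μ {axisOne P} • Measure.dirac (axisOne P) +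
      μ {axisTwo P} • Measure.dirac (axisTwo P) := by
  rw [Measure.restrict_congr_set (hP.ae_fibre hlam hμ), insert_eq,
    Measure.restrict_union (by simpa using axisOne_ne_axisTwo P) (measurableSet_singleton _),
    Measure.restrict_singleton, Measure.restrict_singleton]

theorem Diagonalizes.measure_fibre (hP : Diagonalizes P A lam) (hlam : 1 < lam)
    {μ : Measure BlowUp} [IsFiniteMeasure μ] (hμ : MeasurePreserving (lift A) μ μ) :
    μ fibre = μ {axisOne P} + μ {axisTwo P} := by
  rw [← Measure.restrict_apply_univ, hP.restrict_fibre hlam hμ]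
  simp

/-- Off the exceptional fibre, a measure is determined by its projection to the torus. -/
theorem restrict_compl_fibre_eq {μ ν : Measure BlowUp} (h : μ.map proj = ν.map proj) :
    μ.restrict fibreᶜ = ν.restrict fibreᶜ := by
  refine Measure.ext fun s hs => ?_
  rw [Measure.restrict_apply hs, Measure.restrict_apply hs]
  have hinj : InjOn proj (s ∩ fibreᶜ) := proj_injOn.mono fun x hx => hx.2
  -- The injective image of a Borel set of a Polish space is Borel.
  have himage : MeasurableSet (proj '' (s ∩ fibreᶜ)) :=
    (hs.inter measurableSet_fibre.compl).image_of_measurable_injOn continuous_proj.measurable hinj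
  have hpre : proj ⁻¹' (proj '' (s ∩ fibreᶜ)) = s ∩ fibreᶜ := by
    refine Subset.antisymm ?_ (subset_preimage_image _ _)
    rintro x ⟨y, hy, hyx⟩
    have hx : proj x ≠ 0 := by
      rw [← hyx]
      exact hy.2
    rwa [← proj_injOn hy.2 hx hyx]
  rw [← hpre, ← Measure.map_apply continuous_proj.measurable himage, h,
    Measure.map_apply continuous_proj.measurable himage]

/-- An invariant measure that gives the two fixed points on the exceptional fibre the same mass is
determined by its projection to the torus. -/
theorem Diagonalizes.eq_of_map_proj_eq (hP : Diagonalizes P A lam) (hlam : 1 < lam)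
    {μ ν : Measure BlowUp} [IsFiniteMeasure μ] [IsFiniteMeasure ν]
    (hμ : MeasurePreserving (lift A) μ μ) (hν : MeasurePreserving (lift A) ν ν)
    (hμe : μ {axisOne P} = μ {axisTwo P}) (hνe : ν {axisOne P} = ν {axisTwo P})
    (h : μ.map proj = ν.map proj) : μ = ν := by
  have hfib : μ fibre = ν fibre := by
    have := congrArg (fun m : Measure Torus => m {0}) h
    simpa only [Measure.map_apply continuous_proj.measurable (measurableSet_singleton _),
      fibre] using this
  have hone : μ {axisOne P} = ν {axisOne P} := by
    rw [hP.measure_fibre hlam hμ, hP.measure_fibre hlam hν, ← hμe, ← hνe, ← two_mul,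
      ← two_mul] at hfib
    exact (ENNReal.mul_right_inj two_ne_zero ENNReal.ofNat_ne_top).1 hfib
  rw [← Measure.restrict_add_restrict_compl (μ := μ) measurableSet_fibre,
    ← Measure.restrict_add_restrict_compl (μ := ν) measurableSet_fibre,
    restrict_compl_fibre_eq h, hP.restrict_fibre hlam hμ, hP.restrict_fibre hlam hν, ← hμe, ← hνe,
    hone]

/-- By compactness, an approximation of the projected measure by periodic orbits on the torus lifts
to an approximation of some invariant measure on the blow-up with the same projection. It gives the
two fixed points on the fibre the same mass, since this holds for the periodic orbits and passes to
the limit in terms of the growth cocycle. -/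
theorem Diagonalizes.mem_closure_periodicMeasures (hP : Diagonalizes P A lam) (hlam : 1 < lam)
    {μ : ProbabilityMeasure BlowUp}
    (hμ : MeasurePreserving (lift A) (μ : Measure BlowUp) (μ : Measure BlowUp))
    (he : (μ : Measure BlowUp) {axisOne P} = (μ : Measure BlowUp) {axisTwo P}) :
    μ ∈ closure (periodicMeasures A) := by
  let Φ : ProbabilityMeasure BlowUp → ProbabilityMeasure Torus :=
    fun ν => ν.map continuous_proj.aemeasurable
  have hΦ : Continuous Φ := ProbabilityMeasure.continuous_map continuous_proj
  have hmp : MeasurePreserving (torusMap A) (Φ μ : Measure Torus) (Φ μ : Measure Torus) := by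
    refine ⟨(continuous_torusMap A).measurable, ?_⟩
    have hcomp : torusMap A ∘ proj = proj ∘ lift A := funext fun x => (proj_lift A x).symm
    change ((μ : Measure BlowUp).map proj).map (torusMap A) = (μ : Measure BlowUp).map proj
    rw [Measure.map_map (continuous_torusMap A).measurable continuous_proj.measurable, hcomp,
      ← Measure.map_map continuous_proj.measurable hμ.measurable, hμ.map_eq]
  have hclosed : IsClosed (Φ '' closure (periodicMeasures A)) :=
    (isClosed_closure.isCompact.image hΦ).isClosed
  obtain ⟨ν, hν, hνμ⟩ := closure_minimal (image_mono subset_closure) hclosed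
    (hP.mem_closure_map_proj hlam (Φ μ) hmp)
  have hinv : MeasurePreserving (lift A) (ν : Measure BlowUp) (ν : Measure BlowUp) :=
    closure_minimal (fun _ h => (ergodic_of_mem_periodicMeasures h).toMeasurePreserving)
      (isClosed_setOf_measurePreserving A) hν
  have hzero : ∫ x, growth A x ∂(ν : Measure BlowUp) = 0 := by
    refine closure_minimal (fun η hη => ?_)
      (isClosed_eq (continuous_integral_growth A) continuous_const) hν
    have h0 : ∀ x ∈ fibre, (η : Measure BlowUp).real {x} = 0 := fun x hx => by
      rw [measureReal_def, measure_mono_null (singleton_subset_iff.2 hx)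
        (periodicMeasures_fibre hη), ENNReal.toReal_zero]
    change ∫ x, growth A x ∂(η : Measure BlowUp) = 0
    rw [hP.integral_growth hlam (ergodic_of_mem_periodicMeasures hη).toMeasurePreserving,
      h0 _ rfl, h0 _ rfl, sub_self, mul_zero]
  have hνe : (ν : Measure BlowUp) {axisOne P} = (ν : Measure BlowUp) {axisTwo P} := by
    rw [hP.integral_growth hlam hinv] at hzero
    have := Real.log_pos hlam
    exact (ENNReal.toReal_eq_toReal_iff' (measure_ne_top _ _) (measure_ne_top _ _)).1
      (sub_eq_zero.1 ((mul_eq_zero.1 hzero).resolve_left (by positivity)))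
  have heq : (ν : Measure BlowUp) = (μ : Measure BlowUp) :=
    hP.eq_of_map_proj_eq hlam hinv hμ hνe he
      (congrArg (fun m : ProbabilityMeasure Torus => (m : Measure Torus)) hνμ)
  rwa [ProbabilityMeasure.toMeasure_injective heq] at hν

end Diagonalizes

theorem det_ne_zero_of_eigenvectors {A : Matrix.SpecialLinearGroup (Fin 2) ℤ} {lam : ℝ}
    (hlam : 1 < lam) {v w : ℝ × ℝ} (hv : v ≠ 0) (hw : w ≠ 0) (hAv : planeMap A v = lam • v)
    (hAw : planeMap A w = lam⁻¹ • w) : v.1 * w.2 - v.2 * w.1 ≠ 0 := by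
  refine det_ne_zero_of_mk_ne hv hw fun h => ?_
  obtain ⟨c, rfl⟩ := (Projectivization.mk_eq_mk_iff' ℝ _ _ _ _).1 h
  rw [map_smul, hAw, smul_comm c, ← sub_eq_zero, ← sub_smul] at hAv
  have h1 := inv_lt_one_of_one_lt₀ hlam
  rcases smul_eq_zero.1 hAv with h2 | h2
  · linarith
  · exact hv h2

theorem diagonalizes_basisCoords {A : Matrix.SpecialLinearGroup (Fin 2) ℤ} {lam : ℝ}
    {v w : ℝ × ℝ} (h : v.1 * w.2 - v.2 * w.1 ≠ 0) (hAv : planeMap A v = lam • v)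
    (hAw : planeMap A w = lam⁻¹ • w) : Diagonalizes (basisCoords v w h) A lam := by
  intro z
  rw [basisCoords_apply, basisCoords_apply, map_add, map_smul, map_smul, hAv, hAw, smul_smul,
    smul_smul, mul_comm z.1, mul_comm z.2]

end TorusBlowUp

open TorusBlowUp MeasureTheory Filter in
theorem mainTheorem8 (A : Matrix.SpecialLinearGroup (Fin 2) ℤ) (lam : ℝ) (hlam : 1 < lam)
    (v w : ℝ × ℝ) (hv : v ≠ 0) (hw : w ≠ 0)
    (hAv : planeMap A v = lam • v) (hAw : planeMap A w = lam⁻¹ • w)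
    (p₁ p₂ : BlowUp) (hp₁ : p₁ = BlowUp.dir (Projectivization.mk ℝ v hv))
    (hp₂ : p₂ = BlowUp.dir (Projectivization.mk ℝ w hw))
    (μ : ProbabilityMeasure BlowUp)
    (hμ : MeasurePreserving (diffeo A) (μ : Measure BlowUp) (μ : Measure BlowUp)) :
    ((∃ ν : ℕ → ProbabilityMeasure BlowUp,
        (∀ n, Ergodic (diffeo A) (ν n : Measure BlowUp)) ∧ Tendsto ν atTop (𝓝 μ)) ↔
      ((μ : Measure BlowUp) = Measure.dirac p₁ ∨ (μ : Measure BlowUp) = Measure.dirac p₂) ∨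
        (μ : Measure BlowUp) {p₁} = (μ : Measure BlowUp) {p₂}) ∧
    ((μ : Measure BlowUp) = Measure.dirac p₁ ∨ (μ : Measure BlowUp) = Measure.dirac p₂ →
      ∀ ν : ℕ → ProbabilityMeasure BlowUp,
        (∀ n, Ergodic (diffeo A) (ν n : Measure BlowUp)) → Tendsto ν atTop (𝓝 μ) →
          ∀ᶠ n in atTop, ν n = μ) ∧
    ((μ : Measure BlowUp) {p₁} = (μ : Measure BlowUp) {p₂} →
      ∃ (x : ℕ → BlowUp) (ν : ℕ → ProbabilityMeasure BlowUp),
        (∀ n, x n ∈ Function.periodicPts (diffeo A) ∧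
          (ν n : Measure BlowUp) = orbitMeasure (diffeo A) (x n) ∧
          lyapunovExponents (diffeo A) (x n) = {Real.log lam, -Real.log lam}) ∧
        Tendsto ν atTop (𝓝 μ)) := by
  have hdet := det_ne_zero_of_eigenvectors hlam hv hw hAv hAw
  obtain ⟨P, hP1, hP2, hP⟩ : ∃ P : (ℝ × ℝ) ≃L[ℝ] (ℝ × ℝ), P (1, 0) = v ∧ P (0, 1) = w ∧
      Diagonalizes P A lam :=
    ⟨basisCoords v w hdet, by simp [basisCoords_apply], by simp [basisCoords_apply],
      diagonalizes_basisCoords hdet hAv hAw⟩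
  subst hP1 hP2
  obtain rfl : p₁ = axisOne P := hp₁
  obtain rfl : p₂ = axisTwo P := hp₂
  change MeasurePreserving (lift A) _ _ at hμ
  change ((∃ ν : ℕ → ProbabilityMeasure BlowUp,
      (∀ n, Ergodic (lift A) (ν n : Measure BlowUp)) ∧ _) ↔ _) ∧
    (_ → ∀ ν : ℕ → ProbabilityMeasure BlowUp,
      (∀ n, Ergodic (lift A) (ν n : Measure BlowUp)) → _) ∧
    (_ → ∃ (x : ℕ → BlowUp) (ν : ℕ → ProbabilityMeasure BlowUp),
      (∀ n, x n ∈ Function.periodicPts (lift A) ∧ (ν n : Measure BlowUp) =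
        orbitMeasure (lift A) (x n) ∧ lyapunovExponents (lift A) (x n) = _) ∧ _)
  have happrox : (μ : Measure BlowUp) {axisOne P} = (μ : Measure BlowUp) {axisTwo P} →
      ∃ ν : ℕ → ProbabilityMeasure BlowUp, (∀ n, ν n ∈ periodicMeasures A) ∧
        Tendsto ν atTop (𝓝 μ) := fun he =>
    mem_closure_iff_seq_limit.1 (hP.mem_closure_periodicMeasures hlam hμ he)
  refine ⟨⟨?_, ?_⟩, ?_, ?_⟩
  · rintro ⟨ν, hν, hlim⟩
    by_cases he : (μ : Measure BlowUp) {axisOne P} = (μ : Measure BlowUp) {axisTwo P}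
    · exact Or.inr he
    · exact Or.inl (hP.eventually_eq_of_tendsto hlam hμ he hν hlim).2
  · rintro (h | he)
    · refine ⟨fun _ => μ, fun _ => ?_, tendsto_const_nhds⟩
      rcases h with h | h
      · rw [h]
        exact ergodic_dirac (continuous_lift A).measurable (hP.lift_axisOne hlam)
      · rw [h]
        exact ergodic_dirac (continuous_lift A).measurable hP.lift_axisTwo
    · obtain ⟨ν, hν, hlim⟩ := happrox he
      exact ⟨ν, fun n => ergodic_of_mem_periodicMeasures (hν n), hlim⟩
  · intro h ν hν hlim
    refine (hP.eventually_eq_of_tendsto hlam hμ ?_ hν hlim).1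
    have hne := axisOne_ne_axisTwo P
    rcases h with h | h
    · simp [h, hne]
    · simp [h, hne.symm]
  · intro he
    obtain ⟨ν, hν, hlim⟩ := happrox he
    choose x hx hx0 hxν using hν
    exact ⟨x, ν, fun n => ⟨hx n, hxν n, hP.lyapunovExponents_eq hlam (hx n) (hx0 n)⟩, hlim⟩
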